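/- For sets $X,Y$ of vertices of a finite graph $\Gamma$, let $\mathrm{vol}(X,Y)$ be the number of unordered pairs of distinct vertices with one element in $X$ and the other in $Y$, and let $e_\Gamma(X,Y)$ be the number of edges $xy$ of $\Gamma$ with $x\in X$ and $y\in Y$ (each counted once). For real numbers $p,\beta$, the graph $\Gamma$ is called $(p,\beta)$-jumbled if $$\bigl|e_\Gamma(X,Y)-p\,\mathrm{vol}(X,Y)\bigr|\le \beta\,\mathrm{vol}(X,Y)^{1/2}\qquad\text{for all } X,Y\subseteq V(\Gamma).$$ Let $\mathrm{ex}(\Gamma,H)$ be the maximum number of edges of a subgraph of $\Gamma$ that contains no copy of $H$ as a (not necessarily induced) subgraph, and let $C_\ell$ be the cycle of length $\ell$. Theorem. For every integer $k\ge 1$ and every $\delta>0$ there exists $\gamma>0$ such that for every sequence of densities $p=p(n)\in[0,1]$ there exists $n_0$ such that the following holds for every $n\ge n_0$ with $p(n)>0$. If $\Gamma$ is an $n$-vertex $(p,\beta)$-jumbled graph, where $p=p(n)$ and $\beta$ is a real number satisfying $$\beta\le\gamma\,p^{1+\frac1{2k-1}}\,n\,(\log n)^{-2(k-1)},$$ then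 every subgraph of $\Gamma$ with at least $\left(\frac12+\delta\right)p\binom n2$ edges contains a copy of $C_{2k+1}$; that is, $$\mathrm{ex}(\Gamma,C_{2k+1})<\left(\tfrac12+\delta\right)p\binom n2.$$ -/

import Mathlib

namespace JumbledTuran

/-- The set of unordered pairs of distinct vertices with one element in `X` and the other
in `Y`. The sets `X` and `Y` may overlap; each unordered pair is listed once. -/
def pairsBetween {V : Type*} (X Y : Finset V) : Set (Sym2 V) :=
  {e | ¬ e.IsDiag ∧ ∃ x ∈ X, ∃ y ∈ Y, e = s(x, y)}

/-- `vol X Y` is the number of (unordered) pairs with one element in `X` and the other in `Y`.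
It is `|X| * |Y|` for disjoint `X`, `Y` and `|X|.choose 2` for `X = Y`. -/
noncomputable def vol {V : Type*} (X Y : Finset V) : ℕ :=
  (pairsBetween X Y).ncard

/-- `edgesBetween G X Y` is the number of edges `xy` of `G` with `x ∈ X` and `y ∈ Y`
(each edge is counted once). -/
noncomputable def edgesBetween {V : Type*} (G : SimpleGraph V) (X Y : Finset V) : ℕ :=
  {e | e ∈ G.edgeSet ∧ ∃ x ∈ X, ∃ y ∈ Y, e = s(x, y)}.ncard

/-- A graph `G` is `(p, β)`-jumbled if `|e(X, Y) - p vol(X, Y)| ≤ β vol(X, Y)^{1/2}` for all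
sets `X`, `Y` of vertices. -/
def IsJumbled {V : Type*} (G : SimpleGraph V) (p β : ℝ) : Prop :=
  ∀ X Y : Finset V,
    |(edgesBetween G X Y : ℝ) - p * (vol X Y : ℝ)| ≤ β * Real.sqrt (vol X Y : ℝ)

/-- The generalized Turán number `ex(G, H)`: the maximum number of edges of a subgraph of `G`
containing no copy of `H` as a (not necessarily induced) subgraph. Isolated vertices do not
change the number of edges, so it suffices to consider spanning subgraphs of `G`. The maximum is
attained whenever `G` is finite and `H` has at least one edge. -/
noncomputable def genTuranNumber {V W : Type*} (G : SimpleGraph V) (H : SimpleGraph W) : ℕ :=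
  sSup {m | ∃ G' : SimpleGraph V, G' ≤ G ∧ H.Free G' ∧ G'.edgeSet.ncard = m}

end JumbledTuran

/-! Let `A` and `B` be the adjacency matrices of `Γ` and of its subgraph `G`, let `J` be the
all-ones matrix, and write `A = pJ + M` and `T = pn`. Since `A - B` has nonnegative entries, `tr((A
- B)² B^m) ≥ 0`, so `tr B^(m+2) ≥ 2 tr(A B^(m+1)) - tr(A² B^m)` (`trace_pow_ge`). Replacing `A` by
`pJ` turns the right side into `2pW' - p²nW`, where `W` and `W'` count the walks of length `m` and
`m+1` in `G`. For odd `m`, Chebyshev's inequality gives `W' ≥ (1/2 + δ)pn W`, so `2δp²nW` survives,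
and convexity makes it of order `δT^(m+2)`. With `m = 2k-1` this gives many closed walks of length
`2k+1`, up to errors containing `M` (`trace_pow_ge_of_errors`).

The errors: jumbledness bounds the cut norm of `M` by `2β + p`, hence its operator norm by some `l`
of order `(2β + p) log n` (`sum_mulVec_sq_le_of_cut`). Cutting walks in half bounds the trace errors
by `l‖A^k‖²` in Frobenius norm, which is of order `l n T (p T^(2k-2) + l^(2k-2))`
(`norm_sq_pow_mul_le`). This is negligible when `l` is small against `T` and `l^(2k-1)` against `p
T^(2k-1)`; the second condition is the source of the exponent `1 + 1/(2k-1)`.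

The degenerate walks: without a `C_{2k+1}`, every closed walk of that length splits at a repeated
vertex into two shorter closed walks (`trace_adjMatrix_pow_le_of_free`), and `diag_pow_le` makes
these few unless `p` is tiny. Tiny `p` is excluded because jumbledness itself forces `β` to be at
least of order `√(pn)` when `p < 1/2` (`density_bounds`).

For triangles no logarithm may be lost. There the cut norm is applied directly to pairs of
neighbourhoods, and there are no degenerate closed walks. In all cases the vertices of too large
degree are deleted beforehand, at the cost of few edges (`exists_induced_of_cut`). -/

namespace JumbledTuran

open Matrix
open scoped Matrix.Norms.Frobenius

/-! ### Cut norm, operator norm and Frobenius norm. -/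

section LinearAlgebra

/-- Testing the set of the `j` largest values shows that the `j`-th largest is at most `K/√j`; the
squares then sum to a harmonic number. The induction removes a minimum at each step. -/
lemma sum_sq_le_harmonic {V : Type*} [DecidableEq V] {K : ℝ} {ℓ : V → ℝ} (S : Finset V)
    (h0 : ∀ v ∈ S, 0 ≤ ℓ v) (h : ∀ X ⊆ S, ∑ v ∈ X, ℓ v ≤ K * √(X.card : ℝ)) :
    ∑ v ∈ S, ℓ v ^ 2 ≤ K ^ 2 * (harmonic S.card : ℝ) := by
  induction hm : S.card generalizing S with
  | zero => simp [Finset.card_eq_zero.mp hm]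
  | succ m ih =>
    have hne : S.Nonempty := Finset.card_pos.mp (by omega)
    obtain ⟨s, hs, hmin⟩ := S.exists_min_image ℓ hne
    have hcard : (S.erase s).card = m := by rw [Finset.card_erase_of_mem hs]; omega
    have ih' := ih (S.erase s) (fun v hv => h0 v (Finset.mem_of_mem_erase hv))
      (fun X hX => h X (hX.trans (Finset.erase_subset _ _))) hcard
    have h1 : ((m : ℝ) + 1) * ℓ s ≤ K * √((m : ℝ) + 1) := by
      have h2 := h S subset_rfl
      have h3 : S.card • ℓ s ≤ ∑ v ∈ S, ℓ v := Finset.card_nsmul_le_sum S ℓ _ hmin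
      rw [hm, nsmul_eq_mul] at h3
      rw [hm] at h2
      push_cast at h2 h3
      linarith
    have hpos : (0 : ℝ) < (m : ℝ) + 1 := by positivity
    have h4 : ℓ s ^ 2 ≤ K ^ 2 / ((m : ℝ) + 1) := by
      have h5 := pow_le_pow_left₀ (mul_nonneg hpos.le (h0 s hs)) h1 2
      rw [mul_pow, mul_pow, Real.sq_sqrt hpos.le] at h5
      rw [le_div_iff₀ hpos]
      nlinarith
    rw [← Finset.add_sum_erase S _ hs, harmonic_succ]
    push_cast
    have : K ^ 2 * ((harmonic m : ℝ) + ((m : ℝ) + 1)⁻¹)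
      = K ^ 2 / ((m : ℝ) + 1) + K ^ 2 * (harmonic m : ℝ) := by ring
    rw [this]
    exact add_le_add h4 ih'

lemma harmonic_mono {a b : ℕ} (h : a ≤ b) : harmonic a ≤ harmonic b := by
  induction b, h using Nat.le_induction with
  | base => rfl
  | succ m _ ih =>
    rw [harmonic_succ]
    have : (0 : ℚ) ≤ (((m + 1 : ℕ) : ℚ))⁻¹ := by positivity
    linarith

variable {V ι : Type*} [Fintype V]

/-- A functional that is bounded by `K √|X|` on indicators of sets `X` is bounded in `ℓ²`, up to a
logarithmic factor. -/
lemma sum_sq_le_of_abs_sum_le {K : ℝ} {ℓ : V → ℝ}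
    (h : ∀ X : Finset V, |∑ v ∈ X, ℓ v| ≤ K * √(X.card : ℝ)) :
    ∑ v, ℓ v ^ 2 ≤ 2 * K ^ 2 * (harmonic (Fintype.card V) : ℝ) := by
  classical
  have key : ∀ S : Finset V, K ^ 2 * (harmonic S.card : ℝ)
      ≤ K ^ 2 * (harmonic (Fintype.card V) : ℝ) := fun S =>
    mul_le_mul_of_nonneg_left (by exact_mod_cast harmonic_mono S.card_le_univ) (sq_nonneg K)
  -- The nonnegative and the negative values are treated separately, whence the factor 2.
  have h1 := sum_sq_le_harmonic (K := K) (ℓ := ℓ) (Finset.univ.filter fun v => 0 ≤ ℓ v)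
    (by simp) (fun X _ => (le_abs_self _).trans (h X))
  have h2 := sum_sq_le_harmonic (K := K) (ℓ := fun v => -ℓ v)
    (Finset.univ.filter fun v => ¬ 0 ≤ ℓ v)
    (fun v hv => by
      have := (Finset.mem_filter.mp hv).2
      linarith)
    (fun X _ => by rw [Finset.sum_neg_distrib]; exact (neg_le_abs _).trans (h X))
  simp only [neg_sq] at h2
  have h3 := Finset.sum_filter_add_sum_filter_not Finset.univ (fun v => 0 ≤ ℓ v)
    (fun v => ℓ v ^ 2)
  have := key (Finset.univ.filter fun v => 0 ≤ ℓ v)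
  have := key (Finset.univ.filter fun v => ¬ 0 ≤ ℓ v)
  linarith

/-- The cut norm controls the operator norm up to a logarithmic factor. -/
lemma sum_mulVec_sq_le_of_cut {K : ℝ} {M : Matrix V V ℝ}
    (hM : ∀ X Y : Finset V, |∑ x ∈ X, ∑ y ∈ Y, M x y| ≤ K * √((X.card : ℝ) * Y.card))
    (x : V → ℝ) :
    ∑ v, (M *ᵥ x) v ^ 2
      ≤ (2 * K * (harmonic (Fintype.card V) : ℝ)) ^ 2 * ∑ v, x v ^ 2 := by
  set h : ℝ := (harmonic (Fintype.card V) : ℝ) with hh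
  have hh0 : 0 ≤ h := by
    have := harmonic_mono (Nat.zero_le (Fintype.card V))
    rw [harmonic_zero] at this
    rw [hh]
    exact_mod_cast this
  -- For fixed `X` the cut bound is a bound for a functional of `Y`, with constant `K√|X|`.
  have step1 : ∀ X : Finset V, ∑ w, (∑ v ∈ X, M v w) ^ 2 ≤ 2 * (K ^ 2 * X.card) * h := by
    intro X
    have := sum_sq_le_of_abs_sum_le (K := K * √(X.card : ℝ)) (ℓ := fun w => ∑ v ∈ X, M v w)
      (fun Y => by
        have := hM X Y
        rw [Real.sqrt_mul (by positivity), ← mul_assoc] at this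
        rwa [Finset.sum_comm])
    rwa [mul_pow, Real.sq_sqrt (by positivity)] at this
  -- By duality and Cauchy–Schwarz, `step1` bounds the sums of `M *ᵥ x` over sets, so the same lemma
  -- applies again. Each application costs `√(2h)` in norm, `2h` in total.
  have step2 := sum_sq_le_of_abs_sum_le
    (K := √(∑ v, x v ^ 2) * √(2 * K ^ 2 * h)) (ℓ := M *ᵥ x) (by
      intro X
      have e : ∑ v ∈ X, (M *ᵥ x) v = ∑ w, x w * ∑ v ∈ X, M v w := by
        simp only [Matrix.mulVec, dotProduct, Finset.mul_sum]
        rw [Finset.sum_comm]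
        exact Finset.sum_congr rfl fun _ _ => Finset.sum_congr rfl fun _ _ => mul_comm _ _
      rw [e, mul_assoc, ← Real.sqrt_mul (by positivity), ← Real.sqrt_mul (by positivity)]
      apply Real.abs_le_sqrt
      refine (Finset.sum_mul_sq_le_sq_mul_sq _ _ _).trans ?_
      refine mul_le_mul_of_nonneg_left ?_ (by positivity)
      have := step1 X
      linarith)
  rw [mul_pow, Real.sq_sqrt (by positivity), Real.sq_sqrt (by positivity)] at step2
  refine step2.trans (le_of_eq ?_)
  ring

/-- The all-ones matrix. -/
def ones (V : Type*) : Matrix V V ℝ := Matrix.of fun _ _ => 1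

lemma ones_mul_apply (X : Matrix V ι ℝ) (i : V) (j : ι) : (ones V * X) i j = ∑ v, X v j := by
  simp [ones, Matrix.mul_apply]

variable [Fintype ι]

lemma frobenius_norm_sq (X : Matrix V ι ℝ) : ‖X‖ ^ 2 = ∑ i, ∑ j, X i j ^ 2 := by
  rw [frobenius_norm_def, ← Real.sqrt_eq_rpow, Real.sq_sqrt (by positivity)]
  simp

lemma frobenius_norm_mono {X Y : Matrix V ι ℝ} (h0 : ∀ i j, 0 ≤ X i j)
    (h : ∀ i j, X i j ≤ Y i j) : ‖X‖ ≤ ‖Y‖ := by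
  refine le_of_sq_le_sq ?_ (norm_nonneg _)
  rw [frobenius_norm_sq, frobenius_norm_sq]
  exact Finset.sum_le_sum fun i _ => Finset.sum_le_sum fun j _ =>
    pow_le_pow_left₀ (h0 i j) (h i j) 2

lemma frobenius_norm_mul_le {M : Matrix V V ℝ} {l : ℝ} (hl : 0 ≤ l)
    (hM : ∀ x : V → ℝ, ∑ v, (M *ᵥ x) v ^ 2 ≤ l ^ 2 * ∑ v, x v ^ 2) (X : Matrix V ι ℝ) :
    ‖M * X‖ ≤ l * ‖X‖ := by
  refine le_of_sq_le_sq ?_ (by positivity)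
  rw [mul_pow, frobenius_norm_sq, frobenius_norm_sq, Finset.sum_comm,
    Finset.sum_comm (f := fun i j => X i j ^ 2), Finset.mul_sum]
  exact Finset.sum_le_sum fun j _ => hM fun v => X v j

lemma abs_trace_mul_le (X : Matrix V ι ℝ) (Y : Matrix ι V ℝ) :
    |(X * Y).trace| ≤ ‖X‖ * ‖Y‖ := by
  rw [← Real.sqrt_sq (norm_nonneg X), ← Real.sqrt_sq (norm_nonneg Y),
    ← Real.sqrt_mul (by positivity)]
  apply Real.abs_le_sqrt
  rw [frobenius_norm_sq, frobenius_norm_sq, Finset.sum_comm (f := fun i j => Y i j ^ 2)]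
  simp only [Matrix.trace, Matrix.diag, Matrix.mul_apply]
  rw [← Fintype.sum_prod_type', ← Fintype.sum_prod_type', ← Fintype.sum_prod_type']
  exact Finset.sum_mul_sq_le_sq_mul_sq Finset.univ (fun z : V × ι => X z.1 z.2)
    (fun z => Y z.2 z.1)

lemma frobenius_norm_ones_mul_le {X : Matrix V ι ℝ} {s : ℝ} (h0 : ∀ i j, 0 ≤ X i j)
    (h : ∀ j, ∑ v, X v j ≤ s) (hs : 0 ≤ s) :
    ‖ones V * X‖ ≤ √((Fintype.card V : ℝ) * Fintype.card ι) * s := by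
  refine le_of_sq_le_sq ?_ (by positivity)
  rw [mul_pow, Real.sq_sqrt (by positivity), frobenius_norm_sq]
  simp only [ones_mul_apply]
  calc ∑ _i : V, ∑ j, (∑ v, X v j) ^ 2 ≤ ∑ _i : V, ∑ _j : ι, s ^ 2 :=
        Finset.sum_le_sum fun i _ => Finset.sum_le_sum fun j _ =>
          pow_le_pow_left₀ (Finset.sum_nonneg fun v _ => h0 v j) (h j) 2
    _ = _ := by simp; ring

end LinearAlgebra

end JumbledTuran

namespace JumbledTuran

open Matrix
open scoped Matrix.Norms.Frobenius

/-! ### Norms of powers of a matrix close to a multiple of the all-ones matrix. -/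

section Powers

variable {V ι : Type*} [Fintype V]

lemma entry_mul_nonneg {A : Matrix V V ℝ} (hA : ∀ i j, 0 ≤ A i j) {X : Matrix V ι ℝ}
    (hX : ∀ i j, 0 ≤ X i j) (i : V) (j : ι) : 0 ≤ (A * X) i j := by
  rw [Matrix.mul_apply]
  exact Finset.sum_nonneg fun v _ => mul_nonneg (hA i v) (hX v j)

variable [DecidableEq V]

lemma entry_pow_nonneg {A : Matrix V V ℝ} (hA : ∀ i j, 0 ≤ A i j) (m : ℕ) (i j : V) :
    0 ≤ (A ^ m) i j := by
  induction m generalizing i j with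
  | zero => rw [pow_zero, Matrix.one_apply]; split_ifs <;> norm_num
  | succ m ih =>
    rw [pow_succ, Matrix.mul_apply]
    exact Finset.sum_nonneg fun v _ => mul_nonneg (ih i v) (hA v j)

lemma entry_pow_mono {A B : Matrix V V ℝ} (hB : ∀ i j, 0 ≤ B i j) (hBA : ∀ i j, B i j ≤ A i j)
    (m : ℕ) (i j : V) : (B ^ m) i j ≤ (A ^ m) i j := by
  induction m generalizing i j with
  | zero => simp
  | succ m ih =>
    rw [pow_succ, pow_succ, Matrix.mul_apply, Matrix.mul_apply]
    exact Finset.sum_le_sum fun v _ => mul_le_mul (ih i v) (hBA v j) (hB v j)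
      ((entry_pow_nonneg hB m i v).trans (ih i v))

lemma col_sum_pow_mul_le {A : Matrix V V ℝ} (hA : ∀ i j, 0 ≤ A i j) {D s : ℝ}
    (hD : ∀ j, ∑ i, A i j ≤ D) (hD0 : 0 ≤ D) {X : Matrix V ι ℝ} (hX : ∀ i j, 0 ≤ X i j)
    (hs : ∀ j, ∑ i, X i j ≤ s) (m : ℕ) (j : ι) : ∑ i, (A ^ m * X) i j ≤ D ^ m * s := by
  induction m with
  | zero => simpa using hs j
  | succ m ih =>
    rw [pow_succ', pow_succ', Matrix.mul_assoc, mul_assoc]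
    calc ∑ i, (A * (A ^ m * X)) i j = ∑ v, (∑ i, A i v) * (A ^ m * X) v j := by
          simp only [Matrix.mul_apply (M := A), Finset.sum_mul]
          rw [Finset.sum_comm]
      _ ≤ ∑ v, D * (A ^ m * X) v j := Finset.sum_le_sum fun v _ =>
          mul_le_mul_of_nonneg_right (hD v)
            (entry_mul_nonneg (entry_pow_nonneg hA m) hX v j)
      _ ≤ _ := by
          rw [← Finset.mul_sum]
          exact mul_le_mul_of_nonneg_left ih hD0

variable [Fintype ι]

/-- If `A` is close to `p` times the all-ones matrix, then `A ^ m * X` is flat, up to an error of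
order `l ^ m`. -/
lemma norm_pow_mul_le {A M : Matrix V V ℝ} {p l D s : ℝ} (hAM : A = p • ones V + M)
    (hp : 0 ≤ p) (hl : 0 ≤ l) (hlD : l ≤ D)
    (hM : ∀ x : V → ℝ, ∑ v, (M *ᵥ x) v ^ 2 ≤ l ^ 2 * ∑ v, x v ^ 2)
    (hA : ∀ i j, 0 ≤ A i j) (hD : ∀ j, ∑ i, A i j ≤ D) {X : Matrix V ι ℝ}
    (hX : ∀ i j, 0 ≤ X i j) (hs : ∀ j, ∑ i, X i j ≤ s) (hs0 : 0 ≤ s) (m : ℕ) :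
    ‖A ^ m * X‖ ≤ m * (p * (√((Fintype.card V : ℝ) * Fintype.card ι) * s)) * D ^ (m - 1)
      + l ^ m * ‖X‖ := by
  have hD0 := hl.trans hlD
  set r : ℝ := √((Fintype.card V : ℝ) * Fintype.card ι) with hr
  have hr0 : 0 ≤ r := Real.sqrt_nonneg _
  induction m with
  | zero => simp
  | succ m ih =>
    -- Peel off one factor `A`: the all-ones part sees only column sums, which are at most `D ^ m *
    -- s`, and `M` multiplies the previous bound by `l`.
    have h1 : A ^ (m + 1) * X = p • (ones V * (A ^ m * X)) + M * (A ^ m * X) := by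
      have h0 : ∀ Y : Matrix V ι ℝ, A * Y = p • (ones V * Y) + M * Y := fun Y => by
        rw [hAM, Matrix.add_mul, Matrix.smul_mul]
      rw [pow_succ', Matrix.mul_assoc, h0]
    have h2 : ‖p • (ones V * (A ^ m * X))‖ ≤ p * (r * (D ^ m * s)) := by
      rw [norm_smul, Real.norm_of_nonneg hp]
      exact mul_le_mul_of_nonneg_left (frobenius_norm_ones_mul_le
        (entry_mul_nonneg (entry_pow_nonneg hA m) hX)
        (col_sum_pow_mul_le hA hD hD0 hX hs m) (by positivity)) hp
    have h3 := (frobenius_norm_mul_le hl hM (A ^ m * X)).trans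
      (mul_le_mul_of_nonneg_left ih hl)
    -- For `m = 0` the factor `m` vanishes, so the truncated exponent `m - 1` is harmless; otherwise
    -- `l ≤ D` restores the missing power.
    have h4 : l * (m * (p * (r * s)) * D ^ (m - 1)) ≤ m * (p * (r * s)) * D ^ m := by
      rcases m with _ | m
      · simp
      · rw [Nat.add_sub_cancel, pow_succ D m]
        have : 0 ≤ ((m + 1 : ℕ) : ℝ) * (p * (r * s)) * D ^ m := by positivity
        nlinarith
    rw [h1]
    refine (norm_add_le _ _).trans ?_
    rw [Nat.add_sub_cancel, pow_succ' l]
    push_cast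
    nlinarith

end Powers

/-! ### Walk counts as moments, and the Mantel inequality. -/

section WalkMoments

variable {V : Type*} [Fintype V]

/-- The sum of all entries of a matrix. -/
def total (X : Matrix V V ℝ) : ℝ := ∑ i, ∑ j, X i j

lemma trace_ones_mul (X : Matrix V V ℝ) : (ones V * X).trace = total X := by
  simp only [Matrix.trace, Matrix.diag, ones_mul_apply, total]
  exact Finset.sum_comm

lemma total_ones_mul (X : Matrix V V ℝ) : total (ones V * X) = Fintype.card V * total X := by
  simp only [total, ones_mul_apply, Finset.sum_const, Finset.card_univ, nsmul_eq_mul]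
  rw [Finset.sum_comm]

lemma total_add (X Y : Matrix V V ℝ) : total (X + Y) = total X + total Y := by
  simp [total, Finset.sum_add_distrib]

lemma total_smul (c : ℝ) (X : Matrix V V ℝ) : total (c • X) = c * total X := by
  simp [total, Finset.mul_sum]

variable [DecidableEq V]

/-- The numbers `total (B ^ m)` are the moments of a measure. -/
lemma exists_total_pow_eq {B : Matrix V V ℝ} (hB : B.IsSymm) :
    ∃ c μ : V → ℝ, (∀ i, 0 ≤ c i) ∧ ∀ m : ℕ, total (B ^ m) = ∑ i, c i * μ i ^ m := by
  have hH : B.IsHermitian := by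
    rw [Matrix.IsHermitian, Matrix.conjTranspose_eq_transpose_of_trivial]; exact hB
  set U : Matrix V V ℝ := hH.eigenvectorUnitary.1
  refine ⟨fun i => (∑ v, U v i) ^ 2, hH.eigenvalues, fun i => sq_nonneg _, fun m => ?_⟩
  have h1 : B ^ m = U * diagonal (fun i => hH.eigenvalues i ^ m) * star U := by
    conv_lhs => rw [hH.spectral_theorem, ← map_pow, Unitary.conjStarAlgAut_apply,
      Matrix.diagonal_pow]
    rfl
  rw [h1]
  simp only [total, Matrix.mul_apply (N := star U), Matrix.mul_diagonal, Matrix.star_apply,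
    star_trivial]
  calc ∑ x, ∑ y, ∑ i, U x i * hH.eigenvalues i ^ m * U y i
      = ∑ i, ∑ x, ∑ y, U x i * hH.eigenvalues i ^ m * U y i :=
        (Finset.sum_congr rfl fun x _ => Finset.sum_comm).trans Finset.sum_comm
    _ = _ := by
        refine Finset.sum_congr rfl fun i _ => ?_
        rw [sq, Finset.sum_mul_sum, Finset.sum_mul]
        refine Finset.sum_congr rfl fun x _ => ?_
        rw [Finset.sum_mul]
        exact Finset.sum_congr rfl fun y _ => by ring

lemma total_one : total (1 : Matrix V V ℝ) = Fintype.card V := by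
  simp [total, Matrix.one_apply]

/-- Chebyshev's inequality for the numbers of walks. -/
lemma total_pow_mul_total_le {B : Matrix V V ℝ} (hB : B.IsSymm) (m : ℕ) :
    total (B ^ (2 * m + 1)) * total B ≤ Fintype.card V * total (B ^ (2 * m + 2)) := by
  obtain ⟨c, μ, hc, h⟩ := exists_total_pow_eq hB
  have h0 : (Fintype.card V : ℝ) = ∑ i, c i := by
    have := h 0
    rw [pow_zero, total_one] at this
    simpa using this
  have h1 : total B = ∑ i, c i * μ i := by simpa using h 1
  rw [h0, h1, h, h, Finset.sum_mul_sum, Finset.sum_mul_sum]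
  -- An odd power is increasing on the whole line, so negative eigenvalues do no harm.
  have key : 0 ≤ ∑ i, ∑ j, c i * c j * ((μ i ^ (2 * m + 1) - μ j ^ (2 * m + 1)) * (μ i - μ j)) := by
    refine Finset.sum_nonneg fun i _ => Finset.sum_nonneg fun j _ =>
      mul_nonneg (mul_nonneg (hc i) (hc j)) ?_
    have hmono : StrictMono fun x : ℝ => x ^ (2 * m + 1) := (odd_two_mul_add_one m).strictMono_pow
    rcases le_total (μ i) (μ j) with hij | hij
    · exact mul_nonneg_of_nonpos_of_nonpos (sub_nonpos.mpr (hmono.monotone hij))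
        (sub_nonpos.mpr hij)
    · exact mul_nonneg (sub_nonneg.mpr (hmono.monotone hij)) (sub_nonneg.mpr hij)
  have e : ∑ i, ∑ j, c i * c j * ((μ i ^ (2 * m + 1) - μ j ^ (2 * m + 1)) * (μ i - μ j))
      = (∑ i, ∑ j, c i * (c j * μ j ^ (2 * m + 2))) + (∑ i, ∑ j, c j * (c i * μ i ^ (2 * m + 2)))
        - (∑ i, ∑ j, c i * μ i ^ (2 * m + 1) * (c j * μ j))
        - ∑ i, ∑ j, c j * μ j ^ (2 * m + 1) * (c i * μ i) := by
    simp only [← Finset.sum_add_distrib, ← Finset.sum_sub_distrib]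
    exact Finset.sum_congr rfl fun i _ => Finset.sum_congr rfl fun j _ => by ring
  rw [e, Finset.sum_comm (f := fun i j => c j * (c i * μ i ^ (2 * m + 2))),
    Finset.sum_comm (f := fun i j => c j * μ j ^ (2 * m + 1) * (c i * μ i))] at key
  linarith

/-- Jensen's inequality for the weights `c i / n`. The exponent is even because the eigenvalues may
be negative. -/
lemma total_pow_le {B : Matrix V V ℝ} (hB : B.IsSymm) [Nonempty V] (m : ℕ) :
    (Fintype.card V : ℝ) * (total B / Fintype.card V) ^ (2 * m) ≤ total (B ^ (2 * m)) := by
  obtain ⟨c, μ, hc, h⟩ := exists_total_pow_eq hB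
  have h0 : (Fintype.card V : ℝ) = ∑ i, c i := by
    have := h 0
    rw [pow_zero, total_one] at this
    simpa using this
  have h1 : total B = ∑ i, c i * μ i := by simpa using h 1
  have hn : (0 : ℝ) < Fintype.card V := by exact_mod_cast Fintype.card_pos
  have := Real.pow_arith_mean_le_arith_mean_pow_of_even Finset.univ
    (fun i => c i / Fintype.card V) μ (fun i _ => div_nonneg (hc i) hn.le)
    (by rw [← Finset.sum_div, ← h0, div_self hn.ne']) (even_two_mul m)
  simp only [div_mul_eq_mul_div, ← Finset.sum_div, ← h, ← h1] at this
  rwa [le_div_iff₀ hn, mul_comm] at this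

lemma total_pow_succ_le {B : Matrix V V ℝ} {D : ℝ} (hB0 : ∀ i j, 0 ≤ B i j)
    (hD : ∀ j, ∑ i, B i j ≤ D) (m : ℕ) : total (B ^ (m + 1)) ≤ D * total (B ^ m) := by
  have : total (B ^ (m + 1)) = ∑ j, ∑ v, (∑ i, B i v) * (B ^ m) v j := by
    simp only [total, pow_succ', Matrix.mul_apply, Finset.sum_mul]
    rw [Finset.sum_comm]
    exact Finset.sum_congr rfl fun j _ => Finset.sum_comm
  rw [this, total, Finset.sum_comm (f := fun i j => (B ^ m) i j), Finset.mul_sum]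
  refine Finset.sum_le_sum fun j _ => ?_
  rw [Finset.mul_sum]
  exact Finset.sum_le_sum fun v _ =>
    mul_le_mul_of_nonneg_right (hD v) (entry_pow_nonneg hB0 m v j)

/-- The Mantel-type inequality behind the theorem: count closed walks two of whose consecutive steps
are in `A - B`. -/
lemma trace_pow_ge {A B : Matrix V V ℝ} (hB0 : ∀ i j, 0 ≤ B i j) (hBA : ∀ i j, B i j ≤ A i j)
    (m : ℕ) :
    2 * (A * B ^ (m + 1)).trace - (A * (A * B ^ m)).trace ≤ (B ^ (m + 2)).trace := by
  have h0 : 0 ≤ ((A - B) * ((A - B) * B ^ m)).trace :=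
    Finset.sum_nonneg fun i _ => entry_mul_nonneg (fun i j => sub_nonneg.mpr (hBA i j))
      (entry_mul_nonneg (fun i j => sub_nonneg.mpr (hBA i j)) (entry_pow_nonneg hB0 m)) i i
  have e1 : (B * (A * B ^ m)).trace = (A * B ^ (m + 1)).trace := by
    rw [Matrix.trace_mul_comm, Matrix.mul_assoc, ← pow_succ]
  have e2 : (A - B) * ((A - B) * B ^ m)
      = A * (A * B ^ m) - A * B ^ (m + 1) - B * (A * B ^ m) + B ^ (m + 2) := by
    rw [pow_succ' B (m + 1), pow_succ' B m]
    noncomm_ring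
  rw [e2, Matrix.trace_add, Matrix.trace_sub, Matrix.trace_sub, e1] at h0
  linarith

end WalkMoments

end JumbledTuran

namespace JumbledTuran

open Matrix
open scoped Matrix.Norms.Frobenius

/-! ### Lower bound for closed walks, and control of the error terms. -/

section TraceBounds

variable {V : Type*} [Fintype V]

lemma frobenius_norm_sq_le {ι : Type*} [Fintype ι] {X : Matrix V ι ℝ} {D : ℝ}
    (h0 : ∀ i j, 0 ≤ X i j) (h1 : ∀ i j, X i j ≤ 1) (hD : ∀ j, ∑ i, X i j ≤ D) :
    ‖X‖ ^ 2 ≤ Fintype.card ι * D := by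
  rw [frobenius_norm_sq, Finset.sum_comm]
  calc ∑ j, ∑ i, X i j ^ 2 ≤ ∑ _j : ι, D := Finset.sum_le_sum fun j _ =>
        (Finset.sum_le_sum fun i _ => by nlinarith [h0 i j, h1 i j]).trans (hD j)
    _ = _ := by simp

/-- `M` is applied to the vector of row sums of `Y`, and the result is paired with the constant
vector by Cauchy–Schwarz. -/
lemma abs_total_mul_le {M : Matrix V V ℝ} {l : ℝ} (hl : 0 ≤ l)
    (hM : ∀ x : V → ℝ, ∑ v, (M *ᵥ x) v ^ 2 ≤ l ^ 2 * ∑ v, x v ^ 2)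
    {Y : Matrix V V ℝ} {s : ℝ} (hY : ∀ i j, 0 ≤ Y i j) (hs : ∀ i, ∑ j, Y i j ≤ s) (hs0 : 0 ≤ s) :
    |total (M * Y)| ≤ Fintype.card V * l * s := by
  have e : total (M * Y) = ∑ i, (M *ᵥ fun v => ∑ j, Y v j) i := by
    simp only [total, Matrix.mul_apply, Matrix.mulVec, dotProduct, Finset.mul_sum]
    exact Finset.sum_congr rfl fun i _ => Finset.sum_comm
  rw [e]
  refine abs_le_of_sq_le_sq ?_ (by positivity)
  have h1 := sq_sum_le_card_mul_sum_sq (s := Finset.univ)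
    (f := fun i => (M *ᵥ fun v => ∑ j, Y v j) i)
  refine h1.trans ?_
  have h2 := hM fun v => ∑ j, Y v j
  have h3 : ∑ v, (∑ j, Y v j) ^ 2 ≤ Fintype.card V * s ^ 2 := by
    calc ∑ v, (∑ j, Y v j) ^ 2 ≤ ∑ _v : V, s ^ 2 := Finset.sum_le_sum fun v _ =>
          pow_le_pow_left₀ (Finset.sum_nonneg fun j _ => hY v j) (hs v) 2
      _ = _ := by simp
  rw [Finset.card_univ]
  calc (Fintype.card V : ℝ) * _ ≤ Fintype.card V * (l ^ 2 * (Fintype.card V * s ^ 2)) :=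
        mul_le_mul_of_nonneg_left (h2.trans (mul_le_mul_of_nonneg_left h3 (sq_nonneg l)))
          (by positivity)
    _ = _ := by ring

variable [DecidableEq V]

/-- Lower bound for the number of closed walks of odd length, in terms of three error terms that
measure how far `A` is from `p` times the all-ones matrix. -/
lemma trace_pow_ge_of_errors [Nonempty V] {A B M : Matrix V V ℝ} {p δ E : ℝ} (K : ℕ)
    (hp : 0 < p) (hδ : 0 < δ) (hAM : A = p • ones V + M) (hB : B.IsSymm)
    (hB0 : ∀ i j, 0 ≤ B i j) (hBA : ∀ i j, B i j ≤ A i j)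
    (hD : ∀ j, ∑ i, B i j ≤ 4 * (p * Fintype.card V))
    (htot : (1 / 2 + δ) * p * (Fintype.card V : ℝ) ^ 2 ≤ total B)
    (h1 : |(M * B ^ (2 * K + 2)).trace| ≤ E) (h2 : |(M * (A * B ^ (2 * K + 1))).trace| ≤ E)
    (h3 : p * |total (M * B ^ (2 * K + 1))| ≤ E) :
    δ * (p * Fintype.card V) ^ (2 * K + 3) / 2 ^ (2 * K + 3) - 4 * E
      ≤ (B ^ (2 * K + 3)).trace := by
  set n : ℝ := (Fintype.card V : ℝ) with hn
  have hn0 : 0 < n := by rw [hn]; exact_mod_cast Fintype.card_pos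
  set W := total (B ^ (2 * K + 1)) with hW
  set W' := total (B ^ (2 * K + 2)) with hW'
  have hmantel := trace_pow_ge hB0 hBA (2 * K + 1)
  have hAmul : ∀ Y : Matrix V V ℝ, A * Y = p • (ones V * Y) + M * Y := fun Y => by
    rw [hAM, Matrix.add_mul, Matrix.smul_mul]
  have e1 : (A * B ^ (2 * K + 2)).trace = p * W' + (M * B ^ (2 * K + 2)).trace := by
    rw [hAmul, Matrix.trace_add, Matrix.trace_smul, trace_ones_mul, smul_eq_mul]
  have e2 : (A * (A * B ^ (2 * K + 1))).trace
      = p * (p * (n * W) + total (M * B ^ (2 * K + 1))) + (M * (A * B ^ (2 * K + 1))).trace := by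
    rw [hAmul (A * _), Matrix.trace_add, Matrix.trace_smul, trace_ones_mul, smul_eq_mul,
      hAmul (B ^ _), total_add, total_smul, total_ones_mul]
  have hWnn : 0 ≤ W := Finset.sum_nonneg fun i _ => Finset.sum_nonneg fun j _ =>
    entry_pow_nonneg hB0 _ i j
  have hcheb : W * ((1 / 2 + δ) * p * n) ≤ W' := by
    have := total_pow_mul_total_le hB K
    have h4 := mul_le_mul_of_nonneg_left htot hWnn
    refine le_of_mul_le_mul_left ?_ hn0
    calc n * (W * ((1 / 2 + δ) * p * n)) = W * ((1 / 2 + δ) * p * n ^ 2) := by ring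
      _ ≤ _ := h4.trans this
  -- Convexity bounds only even walk counts from below; the degree bound transfers this to the odd
  -- length `2 * K + 1`.
  have hWlow : n * (p * n / 2) ^ (2 * K + 2) ≤ 4 * (p * n) * W := by
    refine le_trans ?_ (total_pow_succ_le hB0 hD (2 * K + 1))
    refine le_trans ?_ (total_pow_le hB (K + 1))
    rw [← hn, show 2 * (K + 1) = 2 * K + 2 by ring]
    refine mul_le_mul_of_nonneg_left (pow_le_pow_left₀ (by positivity) ?_ _) hn0.le
    rw [le_div_iff₀ hn0]
    refine le_trans ?_ htot
    have : 0 ≤ δ * p * n ^ 2 := by positivity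
    nlinarith
  -- The threshold `1/2` enters here: `hcheb` gives `2pW' ≥ (1 + 2δ)p²nW`, which leaves `2δp²nW`.
  have hfin : δ * (p * n) ^ (2 * K + 3) / 2 ^ (2 * K + 3) ≤ 2 * p * W' - p * (p * (n * W)) := by
    have h5 := mul_le_mul_of_nonneg_left hWlow (show 0 ≤ δ * p / 2 by positivity)
    have h6 := mul_le_mul_of_nonneg_left hcheb (show 0 ≤ 2 * p by positivity)
    calc δ * (p * n) ^ (2 * K + 3) / 2 ^ (2 * K + 3)
        = δ * p / 2 * (n * (p * n / 2) ^ (2 * K + 2)) := by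
          rw [div_pow, pow_succ (p * n), pow_succ (2 : ℝ)]
          field_simp
      _ ≤ δ * p / 2 * (4 * (p * n) * W) := h5
      _ ≤ _ := by linarith
  have a1 := neg_le_of_abs_le h1
  have a2 := le_of_abs_le h2
  have a3 := (mul_le_mul_of_nonneg_left (le_abs_self _) hp.le).trans h3
  rw [show 2 * K + 1 + 1 = 2 * K + 2 by ring, show 2 * K + 1 + 2 = 2 * K + 3 by ring, e1, e2]
    at hmantel
  linarith

lemma add_sq_le_two_mul {a b c : ℝ} (hc : 0 ≤ c) (h : c ≤ a + b) :
    c ^ 2 ≤ 2 * a ^ 2 + 2 * b ^ 2 := by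
  nlinarith [pow_le_pow_left₀ hc h 2, sq_nonneg (a - b)]

variable {A M : Matrix V V ℝ} {p l : ℝ}

/-- The column index `ι` is free so that `X` may be all of `A` or a single column of it, the latter
giving walks from one vertex. -/
lemma norm_sq_pow_mul_le {ι : Type*} [Fintype ι] (hAM : A = p • ones V + M)
    (hp : 0 ≤ p) (hl : 0 ≤ l) (hlT : l ≤ p * Fintype.card V)
    (hM : ∀ x : V → ℝ, ∑ v, (M *ᵥ x) v ^ 2 ≤ l ^ 2 * ∑ v, x v ^ 2)
    (hA : ∀ i j, 0 ≤ A i j) (hD : ∀ j, ∑ i, A i j ≤ 4 * (p * Fintype.card V))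
    {X : Matrix V ι ℝ} (hX : ∀ i j, 0 ≤ X i j) (hX1 : ∀ i j, X i j ≤ 1)
    (hs : ∀ j, ∑ i, X i j ≤ 4 * (p * Fintype.card V)) (m : ℕ) :
    ‖A ^ m * X‖ ^ 2 ≤ (2 * m ^ 2 * 4 ^ (2 * m) + 8) * Fintype.card ι * (p * Fintype.card V) *
      (p * (p * Fintype.card V) ^ (2 * m) + l ^ (2 * m)) := by
  set n : ℝ := (Fintype.card V : ℝ) with hn
  set i : ℝ := (Fintype.card ι : ℝ) with hi
  have hn0 : 0 ≤ n := by positivity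
  have hi0 : 0 ≤ i := by positivity
  set T := p * n with hT
  have hT0 : 0 ≤ T := by positivity
  have h1 := add_sq_le_two_mul (norm_nonneg _)
    (norm_pow_mul_le hAM hp hl (by linarith) hM hA hD hX hs (by positivity) m)
  have h2 := frobenius_norm_sq_le hX hX1 hs
  rw [mul_pow (l ^ m), ← pow_mul, mul_comm m 2] at h1
  have h3 := mul_le_mul_of_nonneg_left h2 (show 0 ≤ l ^ (2 * m) by positivity)
  have h4 : ((m : ℝ) * (p * (√(n * i) * (4 * T))) * (4 * T) ^ (m - 1)) ^ 2
      = m ^ 2 * 4 ^ (2 * m) * i * T * (p * T ^ (2 * m)) := by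
    rcases m with _ | m
    · simp
    · rw [Nat.add_sub_cancel]
      have h5 : √(n * i) ^ 2 = n * i := Real.sq_sqrt (by positivity)
      calc (((m + 1 : ℕ) : ℝ) * (p * (√(n * i) * (4 * T))) * (4 * T) ^ m) ^ 2
          = ((m + 1 : ℕ) : ℝ) ^ 2 * p ^ 2 * √(n * i) ^ 2 * ((4 * T) ^ (m + 1)) ^ 2 := by ring
        _ = ((m + 1 : ℕ) : ℝ) ^ 2 * p * i * T * ((4 * T) ^ (m + 1)) ^ 2 := by rw [h5, hT]; ring
        _ = _ := by rw [← pow_mul, mul_comm (m + 1) 2, mul_pow]; ring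
  have h6 : 0 ≤ i * T * (p * T ^ (2 * m)) := by positivity
  have h7 : 0 ≤ (m : ℝ) ^ 2 * 4 ^ (2 * m) * (i * T * l ^ (2 * m)) := by positivity
  rw [h4] at h1
  nlinarith

/-- A walk is cut in its middle: Cauchy–Schwarz separates the halves `X` and `Y`, and `M` costs its
operator norm. `Z` will be a power of the full adjacency matrix dominating both halves. -/
lemma abs_trace_le (hl : 0 ≤ l)
    (hM : ∀ x : V → ℝ, ∑ v, (M *ᵥ x) v ^ 2 ≤ l ^ 2 * ∑ v, x v ^ 2)
    {X Y Z : Matrix V V ℝ} (hX : ‖X‖ ≤ ‖Z‖) (hY : ‖Y‖ ≤ ‖Z‖) :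
    |(M * (X * Y)).trace| ≤ l * ‖Z‖ ^ 2 := by
  rw [← Matrix.mul_assoc]
  refine (abs_trace_mul_le _ _).trans ?_
  calc ‖M * X‖ * ‖Y‖ ≤ (l * ‖Z‖) * ‖Z‖ := mul_le_mul
        ((frobenius_norm_mul_le hl hM X).trans (mul_le_mul_of_nonneg_left hX hl)) hY
        (norm_nonneg _) (by positivity)
    _ = _ := by ring

/-- Few closed walks of length `b` start at a given vertex. -/
lemma diag_pow_le (hAM : A = p • ones V + M) (hAs : A.IsSymm)
    (hp : 0 ≤ p) (hl : 0 ≤ l) (hlT : l ≤ p * Fintype.card V)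
    (hM : ∀ x : V → ℝ, ∑ v, (M *ᵥ x) v ^ 2 ≤ l ^ 2 * ∑ v, x v ^ 2)
    (hA : ∀ i j, 0 ≤ A i j) (hA1 : ∀ i j, A i j ≤ 1)
    (hD : ∀ j, ∑ i, A i j ≤ 4 * (p * Fintype.card V)) (b : ℕ) (x : V) :
    (A ^ (b + 2)) x x ≤ (2 * b ^ 2 + 24) * 4 ^ b * (p * Fintype.card V) *
      (p * (p * Fintype.card V) ^ b + l ^ b) := by
  set n : ℝ := (Fintype.card V : ℝ) with hn
  have hn0 : 0 ≤ n := by positivity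
  set T := p * n with hT
  have hT0 : 0 ≤ T := by positivity
  -- As `X` is the column of `A` at `x`, the entries of `A ^ m * X` count walks of length `m + 1`
  -- ending at `x`.
  let X : Matrix V Unit ℝ := Matrix.of fun i _ => A i x
  have hAX : ∀ m v, (A ^ m * X) v () = (A ^ (m + 1)) v x := fun m v => by
    simp [X, pow_succ, Matrix.mul_apply]
  have hN' : ∀ m, ‖A ^ m * X‖ ^ 2 = ∑ v, (A ^ (m + 1)) v x ^ 2 := fun m => by
    rw [frobenius_norm_sq]
    exact Finset.sum_congr rfl fun v _ => by simp [hAX]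
  have hN : ∀ m : ℕ, ∑ v, (A ^ (m + 1)) v x ^ 2
      ≤ (2 * (m : ℝ) ^ 2 * 4 ^ (2 * m) + 8) * T * (p * T ^ (2 * m) + l ^ (2 * m)) := fun m => by
    have := norm_sq_pow_mul_le hAM hp hl hlT hM hA hD (X := X)
      (fun i _ => hA i x) (fun i _ => hA1 i x) (fun _ => hD x) m
    rwa [hN', Fintype.card_unit, Nat.cast_one, mul_one] at this
  have hsymm : ∀ m v, (A ^ m) x v = (A ^ m) v x := fun m v => (hAs.pow m).apply v x
  obtain ⟨i, rfl | rfl⟩ := b.even_or_odd'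
  · have e : (A ^ (2 * i + 2)) x x = ∑ v, (A ^ (i + 1)) v x ^ 2 := by
      rw [show 2 * i + 2 = (i + 1) + (i + 1) by ring, pow_add, Matrix.mul_apply]
      exact Finset.sum_congr rfl fun v _ => by rw [hsymm, sq]
    rw [e]
    refine (hN i).trans ?_
    have h4 : (1 : ℝ) ≤ 4 ^ (2 * i) := one_le_pow₀ (by norm_num)
    have h5 : 0 ≤ T * (p * T ^ (2 * i) + l ^ (2 * i)) := by positivity
    rw [mul_assoc _ T, mul_assoc _ T]
    refine mul_le_mul_of_nonneg_right ?_ h5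
    push_cast
    have h6 : 0 ≤ (i : ℝ) ^ 2 * 4 ^ (2 * i) := by positivity
    nlinarith
  -- For odd length a middle step remains between the two halves. Writing it as `pJ + M` gives `p(∑
  -- g)²` plus a quadratic form in `M`.
  · set g : V → ℝ := fun v => (A ^ (i + 1)) v x with hg
    have hg0 : ∀ v, 0 ≤ g v := fun v => entry_pow_nonneg hA _ v x
    have e : (A ^ (2 * i + 1 + 2)) x x = p * (∑ v, g v) ^ 2 + ∑ v, g v * (M *ᵥ g) v := by
      have h1 : (A ^ (2 * i + 1 + 2)) x x = ∑ v, g v * (A *ᵥ g) v := by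
        rw [show 2 * i + 1 + 2 = (i + 1) + (i + 1 + 1) by ring, pow_add, Matrix.mul_apply]
        refine Finset.sum_congr rfl fun v _ => ?_
        rw [hsymm, pow_succ' A (i + 1), Matrix.mul_apply]
        rfl
      have h2 : ∀ v, (A *ᵥ g) v = p * ∑ w, g w + (M *ᵥ g) v := fun v => by
        conv_lhs => rw [hAM]
        rw [Matrix.add_mulVec, Pi.add_apply, Matrix.smul_mulVec, Pi.smul_apply, smul_eq_mul]
        congr 2
        simp [Matrix.mulVec, dotProduct, ones]
      rw [h1]
      simp only [h2, mul_add, Finset.sum_add_distrib, ← Finset.sum_mul]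
      ring
    have h3 : ∑ v, g v ≤ (4 * T) ^ (i + 1) := by
      have := col_sum_pow_mul_le hA hD (by positivity) (X := X) (fun i _ => hA i x)
        (fun _ => hD x) i ()
      simpa only [hAX, ← pow_succ] using this
    have h4 : ∑ v, g v * (M *ᵥ g) v ≤ l * ∑ v, g v ^ 2 := by
      refine le_of_sq_le_sq ((Finset.sum_mul_sq_le_sq_mul_sq _ _ _).trans ?_) (by positivity)
      have := mul_le_mul_of_nonneg_left (hM g) (show 0 ≤ ∑ v, g v ^ 2 by positivity)
      linarith
    have h5 := pow_le_pow_left₀ (Finset.sum_nonneg fun v _ => hg0 v) h3 2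
    have h6 := mul_le_mul_of_nonneg_left h5 hp
    have h7 := mul_le_mul_of_nonneg_left (hN i) hl
    rw [e]
    have h8 : l * (p * T ^ (2 * i) + l ^ (2 * i)) ≤ p * T ^ (2 * i + 1) + l ^ (2 * i + 1) := by
      rw [mul_add, pow_succ' l, pow_succ T]
      have := mul_le_mul_of_nonneg_right hlT (show 0 ≤ p * T ^ (2 * i) by positivity)
      linarith
    have h9 : p * ((4 * T) ^ (i + 1)) ^ 2 = 4 * 4 ^ (2 * i + 1) * T * (p * T ^ (2 * i + 1)) := by
      rw [← pow_mul, mul_pow, show (i + 1) * 2 = 2 * i + 1 + 1 by ring]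
      ring
    have h10 : (2 * (i : ℝ) ^ 2 * 4 ^ (2 * i) + 8) * T * (l * (p * T ^ (2 * i) + l ^ (2 * i)))
        ≤ (2 * (i : ℝ) ^ 2 * 4 ^ (2 * i) + 8) * T * (p * T ^ (2 * i + 1) + l ^ (2 * i + 1)) :=
      mul_le_mul_of_nonneg_left h8 (by positivity)
    set Q := p * T ^ (2 * i + 1) + l ^ (2 * i + 1) with hQ
    have hQ1 : p * T ^ (2 * i + 1) ≤ Q := by
      have : 0 ≤ l ^ (2 * i + 1) := by positivity
      linarith
    have hQ0 : 0 ≤ Q := by positivity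
    have h11 : 4 * 4 ^ (2 * i + 1) * T * (p * T ^ (2 * i + 1)) ≤ 4 * 4 ^ (2 * i + 1) * T * Q :=
      mul_le_mul_of_nonneg_left hQ1 (by positivity)
    have h12 : (2 * (i : ℝ) ^ 2 * 4 ^ (2 * i) + 8) + 4 * 4 ^ (2 * i + 1)
        ≤ (2 * ((2 * i + 1 : ℕ) : ℝ) ^ 2 + 24) * 4 ^ (2 * i + 1) := by
      have h13 : (1 : ℝ) ≤ 4 ^ (2 * i) := one_le_pow₀ (by norm_num)
      have h14 : 0 ≤ (i : ℝ) ^ 2 * 4 ^ (2 * i) := by positivity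
      have h15 : 0 ≤ (i : ℝ) * 4 ^ (2 * i) := by positivity
      rw [pow_succ (4 : ℝ)]
      push_cast
      nlinarith
    have h16 := mul_le_mul_of_nonneg_right h12 (show 0 ≤ T * Q by positivity)
    linarith

end TraceBounds

end JumbledTuran

namespace JumbledTuran

/-! ### Degenerate closed walks. -/

section ClosedWalks

open SimpleGraph

variable {V : Type*} {G : SimpleGraph V}

lemma exists_append_of_le_length {u v : V} (w : G.Walk u v) {i : ℕ} (hi : i ≤ w.length) :
    ∃ (p : G.Walk u (w.getVert i)) (q : G.Walk (w.getVert i) v),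
      w = p.append q ∧ p.length = i ∧ q.length = w.length - i :=
  ⟨w.take i, w.drop i, (w.append_take_drop_eq i).symm, by simp [hi], by simp⟩

/-- A closed walk of length at least 3 is a cycle once its tail is a path. Index 0 is excluded
because the two ends always coincide. -/
lemma exists_getVert_eq_of_not_isCycle {v : V} (w : G.Walk v v) (h3 : 3 ≤ w.length)
    (hw : ¬ w.IsCycle) :
    ∃ i j, i < j ∧ 1 ≤ i ∧ j ≤ w.length ∧ w.getVert i = w.getVert j := by
  by_contra! hcon
  refine hw (Walk.isCycle_iff_isPath_tail_and_le_length.mpr ⟨?_, h3⟩)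
  have hlen : w.tail.length = w.length - 1 := by simp [Walk.tail]
  rw [← Walk.IsPath.getVert_injOn_iff]
  intro i hi j hj hij
  simp only [Set.mem_ofPred_eq, hlen] at hi hj
  rw [Walk.getVert_tail, Walk.getVert_tail] at hij
  rcases lt_trichotomy i j with h | h | h
  · exact absurd hij (hcon (i + 1) (j + 1) (by omega) (by omega) (by omega))
  · exact h
  · exact absurd hij.symm (hcon (j + 1) (i + 1) (by omega) (by omega) (by omega))

variable [Fintype V] [DecidableEq V] [DecidableRel G.Adj]

/-- In a graph without a cycle of length `m`, every closed walk of length `m` splits at a repeated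
vertex into two shorter closed walks. -/
lemma trace_adjMatrix_pow_le_of_free {m : ℕ} (hm : 3 ≤ m)
    (hG : ¬ (cycleGraph m).IsContained G) {R : ℝ} (hR0 : 0 ≤ R)
    (hR : ∀ a b : ℕ, 1 ≤ a → 1 ≤ b → a + b = m →
      ∑ x, (G.adjMatrix ℝ ^ a) x x * (G.adjMatrix ℝ ^ b) x x ≤ R) :
    (G.adjMatrix ℝ ^ m).trace ≤ ((m : ℝ) + 1) ^ 2 * R := by
  classical
  have hcount : ∀ (l : ℕ) (u v : V),
      (G.adjMatrix ℝ ^ l) u v = ((G.finsetWalkLength l u v).card : ℝ) := fun l u v => by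
    rw [adjMatrix_pow_apply_eq_card_walk, card_set_walk_length_eq]
  have hpt : ∀ v, (G.adjMatrix ℝ ^ m) v v
      ≤ ∑ i ∈ Finset.range (m + 1), ∑ j ∈ Finset.range (m + 1), ∑ x,
        if i < j ∧ 1 ≤ i then (G.adjMatrix ℝ ^ i) v x * ((G.adjMatrix ℝ ^ (j - i)) x x *
          (G.adjMatrix ℝ ^ (m - j)) x v) else 0 := fun v => by
    -- If positions `i < j` carry the same vertex `x`, the walk is a concatenation `v → x → x → v`
    -- with lengths `i`, `j - i`, `m - j`.
    have hsub : G.finsetWalkLength m v v ⊆ (Finset.range (m + 1)).biUnion fun i =>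
        (Finset.range (m + 1)).biUnion fun j => Finset.univ.biUnion fun x =>
          if i < j ∧ 1 ≤ i then
            (G.finsetWalkLength i v x ×ˢ (G.finsetWalkLength (j - i) x x ×ˢ
              G.finsetWalkLength (m - j) x v)).image fun t => t.1.append (t.2.1.append t.2.2)
          else ∅ := by
      intro w hw
      rw [mem_finsetWalkLength_iff] at hw
      have hnc : ¬ w.IsCycle := fun hc =>
        hG ((cycleGraph_isContained_iff (by omega)).mpr ⟨v, w, hc, hw⟩)
      obtain ⟨i, j, hij, hi, hj, he⟩ := exists_getVert_eq_of_not_isCycle w (by omega) hnc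
      obtain ⟨p, q, hpq, hp, hq⟩ := exists_append_of_le_length w (i := i) (by omega)
      have hx : q.getVert (j - i) = w.getVert i := by
        have := congrArg (fun z => z.getVert j) hpq
        rw [Walk.getVert_append, if_neg (by omega), hp] at this
        exact this.symm.trans he.symm
      obtain ⟨r, s, hrs, hr, hs⟩ := exists_append_of_le_length q (i := j - i) (by omega)
      simp only [Finset.mem_biUnion, Finset.mem_range, Finset.mem_univ, true_and]
      refine ⟨i, by omega, j, by omega, w.getVert i, ?_⟩
      rw [if_pos ⟨hij, hi⟩, Finset.mem_image]
      refine ⟨(p, r.copy rfl hx, s.copy hx rfl), ?_, ?_⟩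
      · simp only [Finset.mem_product, mem_finsetWalkLength_iff, Walk.length_copy]
        omega
      · simp only [Walk.append_copy_copy, Walk.copy_rfl_rfl]
        rw [← hrs, ← hpq]
    have hcard := (Finset.card_le_card hsub).trans (Finset.card_biUnion_le.trans
      (Finset.sum_le_sum fun i _ => Finset.card_biUnion_le.trans
        (Finset.sum_le_sum fun j _ => Finset.card_biUnion_le)))
    rw [hcount]
    refine (Nat.cast_le (α := ℝ).mpr hcard).trans ?_
    push_cast
    refine Finset.sum_le_sum fun i _ => Finset.sum_le_sum fun j _ =>
      Finset.sum_le_sum fun x _ => ?_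
    split_ifs with h
    · rw [hcount, hcount, hcount]
      refine (Nat.cast_le (α := ℝ).mpr Finset.card_image_le).trans (le_of_eq ?_)
      rw [Finset.card_product, Finset.card_product]
      push_cast
      rfl
    · simp
  have hpair : ∀ i ∈ Finset.range (m + 1), ∀ j ∈ Finset.range (m + 1),
      (∑ v, ∑ x, if i < j ∧ 1 ≤ i then (G.adjMatrix ℝ ^ i) v x *
        ((G.adjMatrix ℝ ^ (j - i)) x x * (G.adjMatrix ℝ ^ (m - j)) x v) else 0) ≤ R := by
    intro i hi j hj
    rw [Finset.mem_range] at hi hj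
    by_cases h : i < j ∧ 1 ≤ i
    · simp only [if_pos h]
      -- Summing over `v` glues the last segment to the first, giving a closed walk at `x` of length
      -- `m - j + i`, positive since `1 ≤ i`.
      refine le_trans (le_of_eq ?_) (hR (j - i) (m - j + i) (by omega) (by omega) (by omega))
      rw [Finset.sum_comm]
      refine Finset.sum_congr rfl fun x _ => ?_
      rw [pow_add, Matrix.mul_apply, Finset.mul_sum]
      exact Finset.sum_congr rfl fun v _ => by ring
    · simpa only [if_neg h, Finset.sum_const_zero] using hR0
  calc (G.adjMatrix ℝ ^ m).trace ≤ ∑ v, ∑ i ∈ Finset.range (m + 1),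
        ∑ j ∈ Finset.range (m + 1), ∑ x,
        if i < j ∧ 1 ≤ i then (G.adjMatrix ℝ ^ i) v x * ((G.adjMatrix ℝ ^ (j - i)) x x *
          (G.adjMatrix ℝ ^ (m - j)) x v) else 0 := Finset.sum_le_sum fun v _ => hpt v
    _ = ∑ i ∈ Finset.range (m + 1), ∑ j ∈ Finset.range (m + 1), ∑ v, ∑ x,
        if i < j ∧ 1 ≤ i then (G.adjMatrix ℝ ^ i) v x * ((G.adjMatrix ℝ ^ (j - i)) x x *
          (G.adjMatrix ℝ ^ (m - j)) x v) else 0 := by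
        rw [Finset.sum_comm]
        exact Finset.sum_congr rfl fun i _ => Finset.sum_comm
    _ ≤ ∑ _i ∈ Finset.range (m + 1), ∑ _j ∈ Finset.range (m + 1), R :=
        Finset.sum_le_sum fun i hi => Finset.sum_le_sum fun j hj => hpair i hi j hj
    _ = _ := by simp; ring

end ClosedWalks

end JumbledTuran

namespace JumbledTuran

open Matrix SimpleGraph
open scoped Matrix.Norms.Frobenius

/-! ### The spectral criterion for cycles of length at least five. -/

section Core

lemma adjMatrix_mono {V : Type*} {G Γ : SimpleGraph V} [DecidableRel G.Adj] [DecidableRel Γ.Adj]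
    (h : G ≤ Γ) (i j : V) : G.adjMatrix ℝ i j ≤ Γ.adjMatrix ℝ i j := by
  rw [adjMatrix_apply, adjMatrix_apply]
  split_ifs with h1 h2 h2
  · exact le_rfl
  · exact absurd (h h1) h2
  · exact zero_le_one
  · exact le_rfl

lemma adjMatrix_nonneg {V : Type*} (G : SimpleGraph V) [DecidableRel G.Adj] (i j : V) :
    0 ≤ G.adjMatrix ℝ i j := by
  rw [adjMatrix_apply]; split_ifs <;> norm_num

lemma adjMatrix_le_one {V : Type*} (G : SimpleGraph V) [DecidableRel G.Adj] (i j : V) :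
    G.adjMatrix ℝ i j ≤ 1 := by
  rw [adjMatrix_apply]; split_ifs <;> norm_num

variable {V : Type*} [Fintype V] [DecidableEq V] {Γ : SimpleGraph V} [DecidableRel Γ.Adj]
  {M : Matrix V V ℝ} {p l : ℝ}

/-- The flat part of the norm bound is absorbed by `h1`, the spectral part by `h2`. -/
lemma trace_errors_le {K : ℕ} {η : ℝ}
    (hΓ : Γ.adjMatrix ℝ = p • ones V + M) (hp : 0 ≤ p) (hl : 0 ≤ l)
    (hM : ∀ x : V → ℝ, ∑ v, (M *ᵥ x) v ^ 2 ≤ l ^ 2 * ∑ v, x v ^ 2)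
    (hD : ∀ j, ∑ i, Γ.adjMatrix ℝ i j ≤ 4 * (p * Fintype.card V))
    (hlT : l ≤ p * Fintype.card V)
    (h1 : l ≤ η * (p * Fintype.card V))
    (h2 : l ^ (2 * K + 1) ≤ η * (p * (p * Fintype.card V) ^ (2 * K + 1))) :
    l * ‖Γ.adjMatrix ℝ ^ (K + 1)‖ ^ 2
      ≤ 2 * (2 * K ^ 2 * 4 ^ (2 * K) + 8) * η * (p * Fintype.card V) ^ (2 * K + 3) := by
  have hN := norm_sq_pow_mul_le hΓ hp hl hlT hM (adjMatrix_nonneg Γ) hD (adjMatrix_nonneg Γ)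
    (adjMatrix_le_one Γ) hD K
  rw [← pow_succ] at hN
  set n : ℝ := (Fintype.card V : ℝ) with hn
  have hn0 : 0 ≤ n := by positivity
  set T := p * n with hT
  have hT0 : 0 ≤ T := by positivity
  set C : ℝ := 2 * K ^ 2 * 4 ^ (2 * K) + 8 with hC
  have hC0 : 0 ≤ C := by positivity
  have h5 := mul_le_mul_of_nonneg_left h1 (show 0 ≤ T * T ^ (2 * K) * T by positivity)
  have h6 := mul_le_mul_of_nonneg_left h2 (show 0 ≤ n * T by positivity)
  calc l * ‖Γ.adjMatrix ℝ ^ (K + 1)‖ ^ 2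
      ≤ l * (C * n * T * (p * T ^ (2 * K) + l ^ (2 * K))) := mul_le_mul_of_nonneg_left hN hl
    _ = C * (p * n * T ^ (2 * K) * T * l + n * T * l ^ (2 * K + 1)) := by ring
    _ = C * (T * T ^ (2 * K) * T * l + n * T * l ^ (2 * K + 1)) := by rw [← hT]
    _ ≤ C * (T * T ^ (2 * K) * T * (η * T) + n * T * (η * (p * T ^ (2 * K + 1)))) :=
        mul_le_mul_of_nonneg_left (add_le_add h5 h6) hC0
    _ = C * (T * T ^ (2 * K) * T * (η * T) + p * n * T * (η * T ^ (2 * K + 1))) := by ring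
    _ = C * (T * T ^ (2 * K) * T * (η * T) + T * T * (η * T ^ (2 * K + 1))) := by rw [← hT]
    _ = _ := by ring

/-- In the product of the two diagonal bounds, every term with a factor `p` is at most `T ^ (2 * K +
2)`, up to constants and the common factor `T ^ 2`, hence too small by a factor `T` (`h4`). The pure
term `n * l ^ (2 * K + 1)` is what `h3` is for. -/
lemma sum_diag_pow_mul_le {G : SimpleGraph V} [DecidableRel G.Adj] {K a b : ℕ} {η : ℝ} (hG : G ≤ Γ)
    (hΓ : Γ.adjMatrix ℝ = p • ones V + M) (hp : 0 ≤ p) (hp1 : p ≤ 1) (hl : 0 ≤ l)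
    (hM : ∀ x : V → ℝ, ∑ v, (M *ᵥ x) v ^ 2 ≤ l ^ 2 * ∑ v, x v ^ 2)
    (hD : ∀ j, ∑ i, Γ.adjMatrix ℝ i j ≤ 4 * (p * Fintype.card V))
    (hlT : l ≤ p * Fintype.card V)
    (h3 : Fintype.card V * l ^ (2 * K + 1) ≤ η * (p * Fintype.card V) ^ (2 * K + 3))
    (h4 : 1 ≤ η * (p * Fintype.card V)) (hab : a + b = 2 * K + 1) :
    ∑ x, (G.adjMatrix ℝ ^ (a + 2)) x x * (G.adjMatrix ℝ ^ (b + 2)) x x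
      ≤ 4 * ((2 * (2 * K + 1) ^ 2 + 24) * 4 ^ (2 * K + 1)) ^ 2 * η *
        (p * Fintype.card V) ^ (2 * K + 5) := by
  set n : ℝ := (Fintype.card V : ℝ) with hn
  have hn0 : 0 ≤ n := by positivity
  set T := p * n with hT
  have hT0 : 0 ≤ T := by positivity
  set C : ℝ := (2 * (2 * K + 1) ^ 2 + 24) * 4 ^ (2 * K + 1) with hC
  have hC0 : 0 ≤ C := by positivity
  have hdiag : ∀ c ≤ 2 * K + 1, ∀ x, (G.adjMatrix ℝ ^ (c + 2)) x x
      ≤ C * T * (p * T ^ c + l ^ c) := fun c hc x => by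
    refine (entry_pow_mono (adjMatrix_nonneg G) (adjMatrix_mono hG) _ x x).trans ?_
    refine (diag_pow_le hΓ Γ.isSymm_adjMatrix hp hl hlT hM (adjMatrix_nonneg Γ)
      (adjMatrix_le_one Γ) hD c x).trans ?_
    refine mul_le_mul_of_nonneg_right (mul_le_mul_of_nonneg_right ?_ hT0) (by positivity)
    have h5 : (c : ℝ) ≤ 2 * K + 1 := by exact_mod_cast hc
    exact mul_le_mul (by gcongr) (pow_le_pow_right₀ (by norm_num) hc) (by positivity)
      (by positivity)
  have hpt : ∀ x, (G.adjMatrix ℝ ^ (a + 2)) x x * (G.adjMatrix ℝ ^ (b + 2)) x x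
      ≤ C * T * (p * T ^ a + l ^ a) * (C * T * (p * T ^ b + l ^ b)) := fun x =>
    mul_le_mul (hdiag a (by omega) x) (hdiag b (by omega) x)
      (entry_pow_nonneg (adjMatrix_nonneg G) _ x x) (by positivity)
  refine (Finset.sum_le_sum fun x _ => hpt x).trans ?_
  rw [Finset.sum_const, Finset.card_univ, nsmul_eq_mul, ← hn]
  have hla : l ^ a ≤ T ^ a := pow_le_pow_left₀ hl hlT a
  have hlb : l ^ b ≤ T ^ b := pow_le_pow_left₀ hl hlT b
  have hTab : T ^ a * T ^ b = T ^ (2 * K + 1) := by rw [← pow_add, hab]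
  have hlab : l ^ a * l ^ b = l ^ (2 * K + 1) := by rw [← pow_add, hab]
  have e : n * (C * T * (p * T ^ a + l ^ a) * (C * T * (p * T ^ b + l ^ b)))
      = C ^ 2 * T ^ 2 * (p * T * (T ^ a * T ^ b) + T * (T ^ a * l ^ b) + T * (l ^ a * T ^ b)
        + n * (l ^ a * l ^ b)) := by
    rw [show p * T * (T ^ a * T ^ b) = p * (p * n) * (T ^ a * T ^ b) by rw [hT],
      show T * (T ^ a * l ^ b) = p * n * (T ^ a * l ^ b) by rw [hT],
      show T * (l ^ a * T ^ b) = p * n * (l ^ a * T ^ b) by rw [hT]]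
    ring
  have e1 : T * (T ^ a * l ^ b) ≤ T * T ^ (2 * K + 1) := by
    rw [← hTab]
    gcongr
  have e2 : T * (l ^ a * T ^ b) ≤ T * T ^ (2 * K + 1) := by
    rw [← hTab]
    gcongr
  have e3 : p * T * T ^ (2 * K + 1) ≤ T * T ^ (2 * K + 1) := by
    have : 0 ≤ T * T ^ (2 * K + 1) := by positivity
    nlinarith
  have e4 : T * T ^ (2 * K + 1) ≤ η * T ^ (2 * K + 3) := by
    have := mul_le_mul_of_nonneg_right h4 (show 0 ≤ T * T ^ (2 * K + 1) by positivity)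
    calc T * T ^ (2 * K + 1) = 1 * (T * T ^ (2 * K + 1)) := (one_mul _).symm
      _ ≤ _ := this
      _ = _ := by ring
  rw [e, hTab, hlab]
  calc C ^ 2 * T ^ 2 * (p * T * T ^ (2 * K + 1) + T * (T ^ a * l ^ b) + T * (l ^ a * T ^ b)
        + n * l ^ (2 * K + 1)) ≤ C ^ 2 * T ^ 2 * (4 * (η * T ^ (2 * K + 3))) :=
        mul_le_mul_of_nonneg_left (by linarith) (by positivity)
    _ = _ := by ring

end Core

/-- Long odd cycles in dense subgraphs of an almost regular graph with small second eigenvalue. -/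
theorem cycleGraph_isContained_of_spectral (K : ℕ) {δ : ℝ} (hδ : 0 < δ) :
    ∃ η : ℝ, 0 < η ∧ ∀ (V : Type*) [Fintype V] [DecidableEq V] [Nonempty V]
      (Γ G : SimpleGraph V) [DecidableRel Γ.Adj] [DecidableRel G.Adj] (M : Matrix V V ℝ) (p l : ℝ),
      G ≤ Γ → Γ.adjMatrix ℝ = p • ones V + M → 0 < p → p ≤ 1 → 0 ≤ l →
      (∀ x : V → ℝ, ∑ v, (M *ᵥ x) v ^ 2 ≤ l ^ 2 * ∑ v, x v ^ 2) →
      (∀ j, ∑ i, Γ.adjMatrix ℝ i j ≤ 4 * (p * Fintype.card V)) →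
      (1 / 2 + δ) * p * (Fintype.card V : ℝ) ^ 2 ≤ total (G.adjMatrix ℝ) →
      l ≤ η * (p * Fintype.card V) →
      l ^ (2 * K + 3) ≤ η * (p * (p * Fintype.card V) ^ (2 * K + 3)) →
      Fintype.card V * l ^ (2 * K + 1) ≤ η * (p * Fintype.card V) ^ (2 * K + 3) →
      1 ≤ η * (p * Fintype.card V) →
      (cycleGraph (2 * K + 5)).IsContained G := by
  obtain ⟨C, hC⟩ : ∃ C : ℝ, C = 4 * ((2 * (2 * K + 1) ^ 2 + 24) * 4 ^ (2 * K + 1)) ^ 2 := ⟨_, rfl⟩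
  obtain ⟨C', hC'⟩ : ∃ C' : ℝ, C' =
    2 * (2 * ((K + 1 : ℕ) : ℝ) ^ 2 * 4 ^ (2 * (K + 1)) + 8) + 4 ^ (2 * K + 3) := ⟨_, rfl⟩
  have hC0 : 0 ≤ C := by rw [hC]; positivity
  have hC'0 : 0 < C' := by rw [hC']; positivity
  -- `C'` bounds each of the errors, which count four times; `C` bounds the degenerate walks for
  -- each of the `(m + 1) ^ 2` pairs of positions. The choice of `η` makes the total at most half
  -- the main term.
  set Q : ℝ := 4 * C' + ((2 * K + 5 : ℕ) + 1 : ℝ) ^ 2 * C with hQ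
  have hQ0 : 0 < Q := by positivity
  have hη0 : 0 < min 1 (δ / 2 ^ (2 * K + 5) / (2 * Q)) := lt_min one_pos (by positivity)
  refine ⟨min 1 (δ / 2 ^ (2 * K + 5) / (2 * Q)), hη0, ?_⟩
  intro V _ _ _ Γ G _ _ M p l hG hΓ hp hp1 hl hM hD htot h1 h2 h3 h4
  set η := min 1 (δ / 2 ^ (2 * K + 5) / (2 * Q)) with hη
  have hη1 : η ≤ 1 := min_le_left _ _
  have hηQ : η * (2 * Q) ≤ δ / 2 ^ (2 * K + 5) :=
    (le_div_iff₀ (by positivity)).mp (min_le_right _ _)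
  by_contra hcon
  have hn0 : (0 : ℝ) < Fintype.card V := by exact_mod_cast Fintype.card_pos
  have hT0 : 0 < p * Fintype.card V := by positivity
  have hlT : l ≤ p * Fintype.card V := h1.trans (mul_le_of_le_one_left hT0.le hη1)
  have hA0 := adjMatrix_nonneg Γ
  have hB0 := adjMatrix_nonneg G
  have hBA := adjMatrix_mono hG
  have hDB : ∀ j, ∑ i, G.adjMatrix ℝ i j ≤ 4 * (p * Fintype.card V) := fun j =>
    (Finset.sum_le_sum fun i _ => hBA i j).trans (hD j)
  have herr := trace_errors_le (K := K + 1) hΓ hp.le hl hM hD hlT h1 h2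
  rw [show 2 * (K + 1) + 3 = 2 * K + 5 by ring] at herr
  have hpos : 0 ≤ η * (p * Fintype.card V) ^ (2 * K + 5) := by positivity
  have hE : l * ‖Γ.adjMatrix ℝ ^ (K + 1 + 1)‖ ^ 2
      ≤ C' * (η * (p * Fintype.card V) ^ (2 * K + 5)) := by
    have h7 : (0 : ℝ) ≤ 4 ^ (2 * K + 3) * (η * (p * Fintype.card V) ^ (2 * K + 5)) := by positivity
    rw [hC', add_mul]
    linarith
  have hnorm : ‖G.adjMatrix ℝ ^ (K + 1 + 1)‖ ≤ ‖Γ.adjMatrix ℝ ^ (K + 1 + 1)‖ :=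
    frobenius_norm_mono (entry_pow_nonneg hB0 _) (entry_pow_mono hB0 hBA _)
  have hnorm' : ‖Γ.adjMatrix ℝ * G.adjMatrix ℝ ^ (K + 1)‖ ≤ ‖Γ.adjMatrix ℝ ^ (K + 1 + 1)‖ := by
    refine frobenius_norm_mono (entry_mul_nonneg hA0 (entry_pow_nonneg hB0 _)) fun i j => ?_
    rw [pow_succ' (Γ.adjMatrix ℝ) (K + 1), Matrix.mul_apply, Matrix.mul_apply]
    exact Finset.sum_le_sum fun v _ =>
      mul_le_mul_of_nonneg_left (entry_pow_mono hB0 hBA _ v j) (hA0 i v)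
  have e1 : |(M * G.adjMatrix ℝ ^ (2 * (K + 1) + 2)).trace|
      ≤ C' * (η * (p * Fintype.card V) ^ (2 * K + 5)) := by
    rw [show 2 * (K + 1) + 2 = (K + 1 + 1) + (K + 1 + 1) by ring, pow_add]
    exact (abs_trace_le hl hM hnorm hnorm).trans hE
  have e2 : |(M * (Γ.adjMatrix ℝ * G.adjMatrix ℝ ^ (2 * (K + 1) + 1))).trace|
      ≤ C' * (η * (p * Fintype.card V) ^ (2 * K + 5)) := by
    -- The halves `A * B ^ (K + 1)` and `B ^ (K + 2)` are both dominated entrywise by `A ^ (K + 2)`.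
    rw [show 2 * (K + 1) + 1 = (K + 1) + (K + 1 + 1) by ring, pow_add,
      ← Matrix.mul_assoc (Γ.adjMatrix ℝ)]
    exact (abs_trace_le hl hM hnorm' hnorm).trans hE
  have e3 : p * |total (M * G.adjMatrix ℝ ^ (2 * (K + 1) + 1))|
      ≤ C' * (η * (p * Fintype.card V) ^ (2 * K + 5)) := by
    have hrow : ∀ i, ∑ j, (G.adjMatrix ℝ ^ (2 * (K + 1) + 1)) i j
        ≤ (4 * (p * Fintype.card V)) ^ (2 * (K + 1) + 1) := fun i => by
      have := col_sum_pow_mul_le hB0 hDB (by positivity) (X := (1 : Matrix V V ℝ)) (s := 1)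
        (fun i j => by rw [Matrix.one_apply]; split_ifs <;> norm_num)
        (fun j => by simp [Matrix.one_apply]) (2 * (K + 1) + 1) i
      rw [mul_one, mul_one] at this
      refine le_trans (le_of_eq (Finset.sum_congr rfl fun j _ => ?_)) this
      exact ((G.isSymm_adjMatrix (α := ℝ)).pow _).apply j i
    have h8 := abs_total_mul_le hl hM (entry_pow_nonneg hB0 _) hrow (by positivity)
    have h9 := mul_le_mul_of_nonneg_left h1
      (show 0 ≤ p * Fintype.card V * (4 * (p * Fintype.card V)) ^ (2 * (K + 1) + 1) by positivity)
    calc p * |total (M * G.adjMatrix ℝ ^ (2 * (K + 1) + 1))|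
        ≤ p * (Fintype.card V * l * (4 * (p * Fintype.card V)) ^ (2 * (K + 1) + 1)) :=
          mul_le_mul_of_nonneg_left h8 hp.le
      _ = p * Fintype.card V * (4 * (p * Fintype.card V)) ^ (2 * (K + 1) + 1) * l := by ring
      _ ≤ _ := h9
      _ = 4 ^ (2 * K + 3) * (η * (p * Fintype.card V) ^ (2 * K + 5)) := by
          rw [mul_pow]; ring
      _ ≤ _ := mul_le_mul_of_nonneg_right (by rw [hC']; exact le_add_of_nonneg_left (by positivity))
          hpos
  have hlow := trace_pow_ge_of_errors (K + 1) hp hδ hΓ G.isSymm_adjMatrix hB0 hBA hDB htot e1 e2 e3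
  have hup := trace_adjMatrix_pow_le_of_free (m := 2 * K + 5) (by omega) hcon
    (R := C * η * (p * Fintype.card V) ^ (2 * K + 5)) (by positivity) (by
      intro a b ha hb hab
      -- A closed walk of length one would be a loop, so only `a, b ≥ 2` contribute.
      rcases Nat.lt_or_ge a 2 with ha2 | ha2
      · obtain rfl : a = 1 := by omega
        simp only [pow_one, adjMatrix_apply, SimpleGraph.irrefl, if_false, zero_mul,
          Finset.sum_const_zero]
        positivity
      rcases Nat.lt_or_ge b 2 with hb2 | hb2
      · obtain rfl : b = 1 := by omega
        simp only [pow_one, adjMatrix_apply, SimpleGraph.irrefl, if_false, mul_zero,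
          Finset.sum_const_zero]
        positivity
      obtain ⟨a, rfl⟩ := Nat.exists_eq_add_of_le' ha2
      obtain ⟨b, rfl⟩ := Nat.exists_eq_add_of_le' hb2
      rw [hC]
      exact sum_diag_pow_mul_le hG hΓ hp.le hp1 hl hM hD hlT h3 h4 (by omega))
  rw [show 2 * (K + 1) + 3 = 2 * K + 5 by ring] at hlow
  have h10 := hlow.trans hup
  have hTm : 0 < (p * Fintype.card V) ^ (2 * K + 5) := by positivity
  have h11 := mul_le_mul_of_nonneg_right hηQ hTm.le
  have h12 : 0 < η * Q * (p * Fintype.card V) ^ (2 * K + 5) := by positivity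
  rw [hQ] at h11 h12
  have e4 : δ * (p * Fintype.card V) ^ (2 * K + 5) / 2 ^ (2 * K + 5)
    = δ / 2 ^ (2 * K + 5) * (p * Fintype.card V) ^ (2 * K + 5) := by ring
  rw [e4] at h10
  nlinarith

/-! ### Triangles, without logarithmic loss. -/

section Triangle

variable {V : Type*} [Fintype V] {M : Matrix V V ℝ} {p l D : ℝ}

/-- The trace sums `M` over pairs of neighbourhoods of a common vertex, so the cut bound applies
vertex by vertex and no operator norm is needed. -/
lemma abs_trace_adjMatrix_mul_le {G H : SimpleGraph V} [DecidableRel G.Adj] [DecidableRel H.Adj]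
    (hl : 0 ≤ l)
    (hM : ∀ X Y : Finset V, |∑ x ∈ X, ∑ y ∈ Y, M x y| ≤ l * √((X.card : ℝ) * Y.card))
    (hG : ∀ v, (G.degree v : ℝ) ≤ D) (hH : ∀ v, (H.degree v : ℝ) ≤ D) (hD : 0 ≤ D) :
    |(M * (G.adjMatrix ℝ * H.adjMatrix ℝ)).trace| ≤ Fintype.card V * (l * D) := by
  have e : (M * (G.adjMatrix ℝ * H.adjMatrix ℝ)).trace
      = ∑ x, ∑ u ∈ H.neighborFinset x, ∑ v ∈ G.neighborFinset x, M u v := by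
    rw [← Matrix.mul_assoc, Matrix.trace_mul_comm]
    simp only [Matrix.trace, Matrix.diag, adjMatrix_mul_apply, mul_adjMatrix_apply]
  rw [e]
  refine (Finset.abs_sum_le_sum_abs _ _).trans ?_
  calc _ ≤ ∑ _x : V, l * D := Finset.sum_le_sum fun x _ => by
        refine (hM _ _).trans (mul_le_mul_of_nonneg_left ?_ hl)
        rw [Real.sqrt_le_left hD, sq, card_neighborFinset_eq_degree, card_neighborFinset_eq_degree]
        exact mul_le_mul (hH x) (hG x) (by positivity) hD
    _ = _ := by simp

lemma abs_total_mul_adjMatrix_le {G : SimpleGraph V} [DecidableRel G.Adj] (hl : 0 ≤ l)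
    (hM : ∀ X Y : Finset V, |∑ x ∈ X, ∑ y ∈ Y, M x y| ≤ l * √((X.card : ℝ) * Y.card))
    (hG : ∀ v, (G.degree v : ℝ) ≤ D) :
    |total (M * G.adjMatrix ℝ)| ≤ D * (2 * (l * Fintype.card V)) := by
  have hn : (0 : ℝ) ≤ Fintype.card V := by positivity
  set c : V → ℝ := fun v => ∑ u, M u v with hc
  have e : total (M * G.adjMatrix ℝ) = ∑ v, c v * G.degree v := by
    simp only [total, mul_adjMatrix_apply, hc]
    rw [Finset.sum_comm]
    have e1 : ∀ j, ∑ i, ∑ u ∈ G.neighborFinset j, M i u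
        = ∑ u, G.adjMatrix ℝ u j * c u := fun j => by
      refine Finset.sum_comm.trans ?_
      simp only [adjMatrix_apply, ite_mul, one_mul, zero_mul, ← Finset.sum_filter, hc]
      exact Finset.sum_congr (by ext u; simp [G.adj_comm]) fun _ _ => rfl
    simp only [e1]
    rw [Finset.sum_comm]
    refine Finset.sum_congr rfl fun u _ => ?_
    rw [← Finset.sum_mul, mul_comm]
    congr 1
    simp [adjMatrix_apply, ← card_neighborFinset_eq_degree, neighborFinset_eq_filter]
  have hX : ∀ X : Finset V, |∑ v ∈ X, c v| ≤ l * Fintype.card V := fun X => by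
    have e2 : ∑ v ∈ X, c v = ∑ u, ∑ v ∈ X, M u v := Finset.sum_comm
    rw [e2]
    refine (hM Finset.univ X).trans (mul_le_mul_of_nonneg_left ?_ hl)
    rw [Real.sqrt_le_left hn, sq, Finset.card_univ]
    exact mul_le_mul_of_nonneg_left (by exact_mod_cast X.card_le_univ) hn
  -- The cut bound is used once on the columns with nonnegative sum and once on the others.
  have habs : ∑ v, |c v| ≤ 2 * (l * Fintype.card V) := by
    rw [← Finset.sum_filter_add_sum_filter_not Finset.univ (fun v => 0 ≤ c v)]
    have h1 : ∑ v ∈ Finset.univ.filter (fun v => 0 ≤ c v), |c v| ≤ l * Fintype.card V := by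
      rw [Finset.sum_congr rfl fun v hv => abs_of_nonneg (Finset.mem_filter.mp hv).2]
      exact (le_abs_self _).trans (hX _)
    have h2 : ∑ v ∈ Finset.univ.filter (fun v => ¬ 0 ≤ c v), |c v| ≤ l * Fintype.card V := by
      rw [Finset.sum_congr rfl fun v hv =>
        abs_of_nonpos (le_of_not_ge (Finset.mem_filter.mp hv).2), Finset.sum_neg_distrib]
      exact (neg_le_abs _).trans (hX _)
    linarith
  rw [e]
  refine (Finset.abs_sum_le_sum_abs _ _).trans ?_
  by_cases hV : Nonempty V
  · have hD : 0 ≤ D := le_trans (by positivity) (hG hV.some)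
    calc ∑ v, |c v * G.degree v| ≤ ∑ v, D * |c v| := Finset.sum_le_sum fun v _ => by
          rw [abs_mul, mul_comm, Nat.abs_cast]
          exact mul_le_mul_of_nonneg_right (hG v) (abs_nonneg _)
      _ ≤ _ := by
          rw [← Finset.mul_sum]
          exact mul_le_mul_of_nonneg_left habs hD
  · rw [not_nonempty_iff] at hV
    simp

/-- Triangles in dense subgraphs of an almost regular graph with small discrepancy. -/
theorem triangle_isContained_of_cut [DecidableEq V] [Nonempty V] {Γ G : SimpleGraph V} [DecidableRel Γ.Adj]
    [DecidableRel G.Adj] {δ : ℝ} (hδ : 0 < δ) (hG : G ≤ Γ)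
    (hΓ : Γ.adjMatrix ℝ = p • ones V + M) (hp : 0 < p) (hp1 : p ≤ 1) (hl : 0 ≤ l)
    (hM : ∀ X Y : Finset V, |∑ x ∈ X, ∑ y ∈ Y, M x y| ≤ l * √((X.card : ℝ) * Y.card))
    (hD : ∀ v, (Γ.degree v : ℝ) ≤ 4 * (p * Fintype.card V))
    (htot : (1 / 2 + δ) * p * (Fintype.card V : ℝ) ^ 2 ≤ total (G.adjMatrix ℝ))
    (hlp : l ≤ δ / 512 * (p * (p * Fintype.card V))) :
    (cycleGraph 3).IsContained G := by
  by_contra hcon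
  have hn0 : (0 : ℝ) < Fintype.card V := by exact_mod_cast Fintype.card_pos
  have hT0 : 0 < p * Fintype.card V := by positivity
  have hDB : ∀ v, (G.degree v : ℝ) ≤ 4 * (p * Fintype.card V) := fun v =>
    le_trans (by exact_mod_cast degree_le_of_le hG) (hD v)
  have hcol : ∀ j, ∑ i, G.adjMatrix ℝ i j ≤ 4 * (p * Fintype.card V) := fun j => by
    refine le_trans (le_of_eq ?_) (hDB j)
    simp [adjMatrix_apply, ← card_neighborFinset_eq_degree, neighborFinset_eq_filter, G.adj_comm]
  -- With this `E` the total error `4 * E` is half of the main term `δ T³ / 2³`.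
  set E := δ / 64 * (p * Fintype.card V) ^ 3 with hE
  have hlE : 8 * (l * (Fintype.card V * (p * Fintype.card V))) ≤ E := by
    have := mul_le_mul_of_nonneg_right hlp
      (show 0 ≤ 8 * (Fintype.card V * (p * Fintype.card V) : ℝ) by positivity)
    calc _ = l * (8 * (Fintype.card V * (p * Fintype.card V))) := by ring
      _ ≤ _ := this
      _ = _ := by rw [hE]; ring
  have hlE0 : 0 ≤ l * (Fintype.card V * (p * Fintype.card V)) := by positivity
  have e1 : |(M * G.adjMatrix ℝ ^ (2 * 0 + 2)).trace| ≤ E := by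
    rw [show 2 * 0 + 2 = 2 by ring, sq]
    refine (abs_trace_adjMatrix_mul_le hl hM hDB hDB (by positivity)).trans ?_
    linarith
  have e2 : |(M * (Γ.adjMatrix ℝ * G.adjMatrix ℝ ^ (2 * 0 + 1))).trace| ≤ E := by
    rw [show 2 * 0 + 1 = 1 by ring, pow_one]
    refine (abs_trace_adjMatrix_mul_le hl hM hD hDB (by positivity)).trans ?_
    linarith
  have e3 : p * |total (M * G.adjMatrix ℝ ^ (2 * 0 + 1))| ≤ E := by
    rw [show 2 * 0 + 1 = 1 by ring, pow_one]
    refine (mul_le_of_le_one_left (abs_nonneg _) hp1).trans ?_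
    refine (abs_total_mul_adjMatrix_le hl hM hDB).trans ?_
    linarith
  have hlow := trace_pow_ge_of_errors 0 hp hδ hΓ G.isSymm_adjMatrix (adjMatrix_nonneg G)
    (adjMatrix_mono hG) hcol htot e1 e2 e3
  have hup := trace_adjMatrix_pow_le_of_free (m := 3) le_rfl hcon (R := 0) le_rfl (by
      intro a b ha hb hab
      have h : a = 1 ∨ b = 1 := by omega
      rcases h with rfl | rfl <;> simp [adjMatrix_apply])
  rw [mul_zero] at hup
  have := hlow.trans hup
  have h3 : 0 < δ * (p * Fintype.card V) ^ 3 := by positivity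
  norm_num at this
  linarith

end Triangle

end JumbledTuran

namespace JumbledTuran

open Matrix SimpleGraph

/-! ### From jumbledness to the cut norm. -/

section Discrepancy

variable {V : Type*}

/-- Volumes become edge counts of the complete graph, so that one double count serves for both. -/
lemma vol_eq_edgesBetween_top (X Y : Finset V) : vol X Y = edgesBetween ⊤ X Y := by
  rw [vol, edgesBetween, pairsBetween]
  congr 1
  ext e
  simp only [Set.mem_ofPred_eq, edgeSet_top, Set.mem_compl_iff, Sym2.mem_diagSet]

lemma total_adjMatrix [Fintype V] (G : SimpleGraph V) [DecidableRel G.Adj] :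
    total (G.adjMatrix ℝ) = 2 * G.edgeSet.ncard := by
  have h1 := G.sum_degrees_eq_twice_card_edges
  rw [← coe_edgeFinset, Set.ncard_coe_finset]
  have h2 : total (G.adjMatrix ℝ) = ((∑ v, G.degree v : ℕ) : ℝ) := by
    rw [Nat.cast_sum, total]
    exact Finset.sum_congr rfl fun v _ => by
      simp [adjMatrix_apply, ← card_neighborFinset_eq_degree, neighborFinset_eq_filter]
  rw [h2, h1]
  push_cast
  rfl

variable [DecidableEq V]

lemma edgesBetween_eq_card_image (H : SimpleGraph V) [DecidableRel H.Adj] (X Y : Finset V) :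
    edgesBetween H X Y
      = (((X ×ˢ Y).filter fun z => H.Adj z.1 z.2).image fun z => s(z.1, z.2)).card := by
  rw [edgesBetween, ← Set.ncard_coe_finset]
  congr 1
  ext e
  simp only [Set.mem_ofPred_eq, Finset.coe_image, Set.mem_image, Finset.mem_coe,
    Finset.mem_filter, Finset.mem_product, Prod.exists]
  constructor
  · rintro ⟨he, x, hx, y, hy, rfl⟩
    exact ⟨x, y, ⟨⟨hx, hy⟩, he⟩, rfl⟩
  · rintro ⟨x, y, ⟨⟨hx, hy⟩, he⟩, rfl⟩
    exact ⟨he, x, hx, y, hy, rfl⟩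

/-- Ordered pairs of adjacent vertices, counted by edges. -/
lemma card_filter_adj_eq (H : SimpleGraph V) [DecidableRel H.Adj] (X Y : Finset V) :
    ((X ×ˢ Y).filter fun z => H.Adj z.1 z.2).card
      = edgesBetween H X Y + edgesBetween H (X ∩ Y) (X ∩ Y) := by
  rw [edgesBetween_eq_card_image, edgesBetween_eq_card_image]
  set P := (X ×ˢ Y).filter fun z => H.Adj z.1 z.2 with hP
  set Q := ((X ∩ Y) ×ˢ (X ∩ Y)).filter fun z => H.Adj z.1 z.2 with hQ
  set f : V × V → Sym2 V := fun z => s(z.1, z.2) with hf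
  have hQP : Q.image f ⊆ P.image f := by
    refine Finset.image_subset_image fun z hz => ?_
    simp only [hP, hQ, Finset.mem_filter, Finset.mem_product, Finset.mem_inter] at hz ⊢
    exact ⟨⟨hz.1.1.1, hz.1.2.2⟩, hz.2⟩
  rw [Finset.card_eq_sum_card_image f P]
  -- An edge arises from two ordered pairs exactly when both its ends lie in `X ∩ Y`.
  have hfib : ∀ e ∈ P.image f,
      (P.filter fun z => f z = e).card = 1 + if e ∈ Q.image f then 1 else 0 := by
    intro e he
    obtain ⟨⟨x, y⟩, hxy, rfl⟩ := Finset.mem_image.mp he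
    simp only [hP, Finset.mem_filter, Finset.mem_product] at hxy
    obtain ⟨⟨hx, hy⟩, hadj⟩ := hxy
    have hmem : f (x, y) ∈ Q.image f ↔ x ∈ Y ∧ y ∈ X := by
      simp only [hQ, hf, Finset.mem_image, Finset.mem_filter, Finset.mem_product,
        Finset.mem_inter, Prod.exists, Sym2.eq_iff]
      constructor
      · rintro ⟨a, b, ⟨⟨⟨ha, ha'⟩, hb, hb'⟩, -⟩, ⟨rfl, rfl⟩ | ⟨rfl, rfl⟩⟩
        · exact ⟨ha', hb⟩
        · exact ⟨hb', ha⟩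
      · rintro ⟨h1, h2⟩
        exact ⟨x, y, ⟨⟨⟨hx, h1⟩, h2, hy⟩, hadj⟩, Or.inl ⟨rfl, rfl⟩⟩
    by_cases h : x ∈ Y ∧ y ∈ X
    · rw [if_pos (hmem.mpr h)]
      have : (P.filter fun z => f z = f (x, y)) = {(x, y), (y, x)} := by
        ext ⟨a, b⟩
        simp only [hP, hf, Finset.mem_filter, Finset.mem_product, Sym2.eq_iff,
          Finset.mem_insert, Finset.mem_singleton, Prod.mk.injEq]
        constructor
        · exact fun hab => hab.2
        · rintro (⟨rfl, rfl⟩ | ⟨rfl, rfl⟩)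
          · exact ⟨⟨⟨hx, hy⟩, hadj⟩, Or.inl ⟨rfl, rfl⟩⟩
          · exact ⟨⟨⟨h.2, h.1⟩, hadj.symm⟩, Or.inr ⟨rfl, rfl⟩⟩
      rw [this, Finset.card_pair]
      exact fun h' => hadj.ne (Prod.mk.inj h').1
    · rw [if_neg (hmem.not.mpr h)]
      have : (P.filter fun z => f z = f (x, y)) = {(x, y)} := by
        ext ⟨a, b⟩
        simp only [hP, hf, Finset.mem_filter, Finset.mem_product, Sym2.eq_iff,
          Finset.mem_singleton, Prod.mk.injEq]
        constructor
        · rintro ⟨⟨⟨ha, hb⟩, -⟩, hab | ⟨rfl, rfl⟩⟩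
          · exact hab
          · exact absurd ⟨hb, ha⟩ h
        · rintro ⟨rfl, rfl⟩
          exact ⟨⟨⟨hx, hy⟩, hadj⟩, Or.inl ⟨rfl, rfl⟩⟩
      rw [this, Finset.card_singleton]
  rw [Finset.sum_congr rfl hfib, Finset.sum_add_distrib, Finset.sum_const, smul_eq_mul, mul_one,
    ← Finset.sum_filter, Finset.sum_const, smul_eq_mul, mul_one]
  congr 2
  ext e
  simp only [Finset.mem_filter]
  exact ⟨fun h => h.2, fun h => ⟨hQP h, h⟩⟩

/-- Jumbledness bounds the cut norm of `A - p J`. -/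
lemma abs_sum_le_of_isJumbled {Γ : SimpleGraph V} [DecidableRel Γ.Adj] {p β : ℝ} (hp : 0 ≤ p)
    (hβ : 0 ≤ β) (h : IsJumbled Γ p β) (X Y : Finset V) :
    |∑ x ∈ X, ∑ y ∈ Y, (Γ.adjMatrix ℝ - p • ones V) x y|
      ≤ (2 * β + p) * √((X.card : ℝ) * Y.card) := by
  have hA : ∑ x ∈ X, ∑ y ∈ Y, Γ.adjMatrix ℝ x y
      = (edgesBetween Γ X Y : ℝ) + edgesBetween Γ (X ∩ Y) (X ∩ Y) := by
    have := card_filter_adj_eq Γ X Y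
    rw [← Nat.cast_add, ← this, Finset.card_filter, Nat.cast_sum, Finset.sum_product]
    simp [adjMatrix_apply]
  have hJ : (X.card : ℝ) * Y.card
      = (vol X Y : ℝ) + vol (X ∩ Y) (X ∩ Y) + (X ∩ Y).card := by
    have h1 := card_filter_adj_eq (⊤ : SimpleGraph V) X Y
    have h2 : ((X ×ˢ Y).filter fun z => ¬ (⊤ : SimpleGraph V).Adj z.1 z.2).card
        = (X ∩ Y).card := by
      rw [← Finset.card_map ⟨fun v : V => (v, v), fun a b hab => (Prod.mk.inj hab).1⟩]
      congr 1
      ext ⟨a, b⟩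
      simp only [Finset.mem_filter, Finset.mem_product, top_adj, not_not, Finset.mem_map,
        Finset.mem_inter]
      constructor
      · rintro ⟨⟨ha, hb⟩, rfl⟩
        exact ⟨a, ⟨ha, hb⟩, rfl⟩
      · rintro ⟨c, ⟨ha, hb⟩, h⟩
        cases h
        exact ⟨⟨ha, hb⟩, rfl⟩
    have h3 := Finset.card_filter_add_card_filter_not (s := X ×ˢ Y)
      (fun z => (⊤ : SimpleGraph V).Adj z.1 z.2)
    rw [h1, h2, ← vol_eq_edgesBetween_top, ← vol_eq_edgesBetween_top, Finset.card_product] at h3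
    exact_mod_cast h3.symm
  -- Two discrepancies, for `(X, Y)` and for `X ∩ Y` with itself, and a diagonal correction: this is
  -- the origin of `2 * β + p`.
  have e : ∑ x ∈ X, ∑ y ∈ Y, (Γ.adjMatrix ℝ - p • ones V) x y
      = ((edgesBetween Γ X Y : ℝ) - p * vol X Y)
        + ((edgesBetween Γ (X ∩ Y) (X ∩ Y) : ℝ) - p * vol (X ∩ Y) (X ∩ Y))
        - p * (X ∩ Y).card := by
    have : ∑ x ∈ X, ∑ y ∈ Y, (Γ.adjMatrix ℝ - p • ones V) x y
        = ∑ x ∈ X, ∑ y ∈ Y, Γ.adjMatrix ℝ x y - p * ((X.card : ℝ) * Y.card) := by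
      simp [ones, Finset.sum_sub_distrib]
      ring
    rw [this, hA, hJ]
    ring
  have h1 : √(vol X Y : ℝ) ≤ √((X.card : ℝ) * Y.card) := Real.sqrt_le_sqrt (by
    rw [hJ]; linarith [Nat.cast_nonneg (α := ℝ) (vol (X ∩ Y) (X ∩ Y)),
      Nat.cast_nonneg (α := ℝ) (X ∩ Y).card])
  have h2 : √(vol (X ∩ Y) (X ∩ Y) : ℝ) ≤ √((X.card : ℝ) * Y.card) := Real.sqrt_le_sqrt (by
    rw [hJ]; linarith [Nat.cast_nonneg (α := ℝ) (vol X Y),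
      Nat.cast_nonneg (α := ℝ) (X ∩ Y).card])
  have h3 : ((X ∩ Y).card : ℝ) ≤ √((X.card : ℝ) * Y.card) := by
    apply Real.le_sqrt_of_sq_le
    rw [sq]
    gcongr
    · exact Finset.inter_subset_left
    · exact Finset.inter_subset_right
  rw [e]
  have a1 := h X Y
  have a2 := h (X ∩ Y) (X ∩ Y)
  have b1 := mul_le_mul_of_nonneg_left h1 hβ
  have b2 := mul_le_mul_of_nonneg_left h2 hβ
  have b3 := mul_le_mul_of_nonneg_left h3 hp
  rw [abs_le] at a1 a2 ⊢
  have : 0 ≤ p * ((X ∩ Y).card : ℝ) := by positivity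
  constructor <;> linarith [a1.1, a1.2, a2.1, a2.2]

variable [Fintype V]

/-- Between `v` and its neighbourhood every pair is an edge, so the discrepancy is `(1 - p) deg v`,
while the volume is only `deg v`. -/
lemma sqrt_degree_le_of_isJumbled {Γ : SimpleGraph V} [DecidableRel Γ.Adj] {p β : ℝ}
    (h : IsJumbled Γ p β) {v : V} (h0 : 0 < Γ.degree v) :
    (1 - p) * √(Γ.degree v : ℝ) ≤ β := by
  have key : ∀ H : SimpleGraph V, (∀ w, Γ.Adj v w → H.Adj v w) →
      edgesBetween H {v} (Γ.neighborFinset v) = Γ.degree v := by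
    intro H hH
    rw [edgesBetween, ← card_neighborFinset_eq_degree,
      ← Finset.card_image_of_injective (f := fun w => s(v, w)) _ (fun _ _ hab => Sym2.congr_right.mp hab),
      ← Set.ncard_coe_finset]
    congr 1
    ext e
    simp only [Set.mem_ofPred_eq, Finset.mem_singleton, exists_eq_left, mem_neighborFinset,
      Finset.coe_image, Set.mem_image, Finset.mem_coe]
    constructor
    · rintro ⟨-, y, hy, rfl⟩
      exact ⟨y, hy, rfl⟩
    · rintro ⟨y, hy, rfl⟩
      exact ⟨hH y hy, y, hy, rfl⟩
  have h1 := h {v} (Γ.neighborFinset v)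
  rw [vol_eq_edgesBetween_top, key Γ fun _ hw => hw, key ⊤ fun _ hw => hw.ne] at h1
  have h2 : (0 : ℝ) < Γ.degree v := by exact_mod_cast h0
  have h3 : 0 < √(Γ.degree v : ℝ) := Real.sqrt_pos.mpr h2
  have h4 := (le_abs_self _).trans h1
  refine le_of_mul_le_mul_right ?_ h3
  rw [mul_assoc, Real.mul_self_sqrt h2.le]
  linarith

end Discrepancy

end JumbledTuran

namespace JumbledTuran

open Matrix SimpleGraph

/-! ### Deleting vertices of large degree. -/

section Restriction

variable {V : Type*} [Fintype V] {Γ G : SimpleGraph V} [DecidableRel Γ.Adj]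
  [DecidableRel G.Adj] {p l δ κ : ℝ}

lemma sum_adjMatrix_row (H : SimpleGraph V) [DecidableRel H.Adj] (v : V) :
    ∑ w, H.adjMatrix ℝ v w = H.degree v := by
  simp [adjMatrix_apply, ← card_neighborFinset_eq_degree, neighborFinset_eq_filter]

/-- Few vertices have large degree, and few edges touch them. -/
lemma exists_finset_degree_le (hG : G ≤ Γ) (hp : 0 < p) (hδ : 0 < δ)
    (hcut : ∀ X Y : Finset V, |∑ x ∈ X, ∑ y ∈ Y, (Γ.adjMatrix ℝ - p • ones V) x y|
      ≤ l * √((X.card : ℝ) * Y.card))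
    (hlκ : l ^ 2 ≤ κ * (p * Fintype.card V) ^ 2) (hκ0 : 0 ≤ κ) (hκ : κ ≤ 1 / 2)
    (hκδ : 16 * κ ≤ δ) (hn : 2 + 4 * δ ≤ δ * Fintype.card V)
    (htot : (1 / 2 + δ) * p * (Fintype.card V * (Fintype.card V - 1)) ≤ total (G.adjMatrix ℝ)) :
    ∃ U : Finset V, (Fintype.card V : ℝ) ≤ 2 * U.card ∧
      (∀ v ∈ U, (Γ.degree v : ℝ) ≤ 2 * (p * Fintype.card V)) ∧
      (1 / 2 + δ / 2) * p * (U.card : ℝ) ^ 2 ≤ ∑ x ∈ U, ∑ y ∈ U, G.adjMatrix ℝ x y := by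
  set n : ℝ := (Fintype.card V : ℝ) with hndef
  have hn0 : 0 < n := by
    by_contra hcon
    have : δ * n ≤ 0 := mul_nonpos_of_nonneg_of_nonpos hδ.le (not_lt.mp hcon)
    linarith
  set U := Finset.univ.filter fun v => (Γ.degree v : ℝ) ≤ 2 * (p * n) with hU
  set W := Finset.univ.filter fun v => ¬ (Γ.degree v : ℝ) ≤ 2 * (p * n) with hW
  have hUW : (U.card : ℝ) + W.card = n := by
    have := Finset.card_filter_add_card_filter_not (s := (Finset.univ : Finset V))
      (fun v => (Γ.degree v : ℝ) ≤ 2 * (p * n))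
    rw [hndef, ← Finset.card_univ]
    exact_mod_cast this
  set D := ∑ x ∈ W, (Γ.degree x : ℝ) with hD
  -- The set `W` of large degrees is tested against all vertices: its edge count is at least twice
  -- the expected one, so `W` must be small.
  have hcutW : D - p * (W.card * n) ≤ l * √((W.card : ℝ) * n) := by
    have h1 := (le_abs_self _).trans (hcut W Finset.univ)
    have h2 : ∑ x ∈ W, ∑ y, (Γ.adjMatrix ℝ - p • ones V) x y = D - p * (W.card * n) := by
      rw [hD]
      simp only [Matrix.sub_apply, Finset.sum_sub_distrib, sum_adjMatrix_row]
      simp [ones, hndef]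
      ring
    rwa [h2, Finset.card_univ] at h1
  have hDlow : 2 * (p * n) * W.card ≤ D := by
    rw [mul_comm, ← nsmul_eq_mul]
    exact Finset.card_nsmul_le_sum W _ _ fun v hv =>
      (not_le.mp (Finset.mem_filter.mp hv).2).le
  have hw0 : (0 : ℝ) ≤ W.card := by positivity
  have hsq : (p * (W.card * n)) ^ 2 ≤ l ^ 2 * (W.card * n) := by
    have h1 : p * (W.card * n) ≤ l * √((W.card : ℝ) * n) := by linarith
    have h2 := pow_le_pow_left₀ (by positivity) h1 2
    rwa [mul_pow l, Real.sq_sqrt (by positivity)] at h2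
  have hWcard : (W.card : ℝ) ≤ κ * n := by
    rcases hw0.eq_or_lt with h0 | h0
    · rw [← h0]; positivity
    have h1 := hsq.trans (mul_le_mul_of_nonneg_right hlκ (by positivity))
    refine le_of_mul_le_mul_left ?_ (show 0 < p ^ 2 * n ^ 2 * W.card by positivity)
    linarith
  have hroot : l * √((W.card : ℝ) * n) ≤ κ * (p * n ^ 2) := by
    refine le_of_sq_le_sq ?_ (by positivity)
    rw [mul_pow, Real.sq_sqrt (by positivity)]
    calc l ^ 2 * (W.card * n) ≤ κ * (p * n) ^ 2 * (κ * n * n) := by gcongr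
      _ = _ := by ring
  have hDup : D ≤ 2 * κ * (p * n ^ 2) := by
    have : p * (W.card * n) ≤ p * (κ * n * n) := by gcongr
    linarith
  refine ⟨U, ?_, fun v hv => (Finset.mem_filter.mp hv).2, ?_⟩
  · have : κ * n ≤ 1 / 2 * n := mul_le_mul_of_nonneg_right hκ hn0.le
    linarith
  have hrow : ∀ X : Finset V, ∑ x ∈ W, ∑ y ∈ X, G.adjMatrix ℝ x y ≤ D := fun X =>
    Finset.sum_le_sum fun x _ => by
      calc ∑ y ∈ X, G.adjMatrix ℝ x y ≤ ∑ y, G.adjMatrix ℝ x y :=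
            Finset.sum_le_sum_of_subset_of_nonneg X.subset_univ
              fun y _ _ => adjMatrix_nonneg G x y
        _ = G.degree x := sum_adjMatrix_row G x
        _ ≤ Γ.degree x := by exact_mod_cast degree_le_of_le hG
  have hsplit : total (G.adjMatrix ℝ) = ∑ x ∈ U, ∑ y ∈ U, G.adjMatrix ℝ x y
      + ∑ x ∈ W, ∑ y ∈ U, G.adjMatrix ℝ x y + ∑ x ∈ W, ∑ y, G.adjMatrix ℝ x y := by
    rw [total, ← Finset.sum_filter_add_sum_filter_not Finset.univ
      (fun v => (Γ.degree v : ℝ) ≤ 2 * (p * n))]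
    congr 1
    have h1 : ∀ x, ∑ y, G.adjMatrix ℝ x y
        = ∑ y ∈ U, G.adjMatrix ℝ x y + ∑ y ∈ W, G.adjMatrix ℝ x y := fun x =>
      (Finset.sum_filter_add_sum_filter_not Finset.univ _ _).symm
    simp only [h1, Finset.sum_add_distrib]
    congr 1
    refine Finset.sum_comm.trans (Finset.sum_congr rfl fun x _ => Finset.sum_congr rfl fun y _ => ?_)
    exact G.isSymm_adjMatrix.apply _ _
  have h1 := hrow U
  have h2 := hrow Finset.univ
  have hUn : (U.card : ℝ) ^ 2 ≤ n ^ 2 := pow_le_pow_left₀ (by positivity) (by linarith) 2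
  have h3 : (1 / 2 + δ / 2) * p * (U.card : ℝ) ^ 2 ≤ (1 / 2 + δ / 2) * p * n ^ 2 := by gcongr
  -- The surplus `δ/2` is spent in two equal halves: `h4` pays for `n(n-1)` in place of `n²`, and
  -- `h5` for the edges at `W`.
  have h4 : p * n * (2 + 4 * δ) ≤ p * n * (δ * n) := by gcongr
  have h5 : 16 * κ * (p * n ^ 2) ≤ δ * (p * n ^ 2) := by gcongr
  linarith

/-- Passing to an induced subgraph of bounded degree. -/
lemma exists_induced_of_cut (hG : G ≤ Γ) (hp : 0 < p) (hδ : 0 < δ)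
    (hcut : ∀ X Y : Finset V, |∑ x ∈ X, ∑ y ∈ Y, (Γ.adjMatrix ℝ - p • ones V) x y|
      ≤ l * √((X.card : ℝ) * Y.card))
    (hlκ : l ^ 2 ≤ κ * (p * Fintype.card V) ^ 2) (hκ0 : 0 ≤ κ) (hκ : κ ≤ 1 / 2)
    (hκδ : 16 * κ ≤ δ) (hn : 2 + 4 * δ ≤ δ * Fintype.card V)
    (htot : (1 / 2 + δ) * p * (Fintype.card V * (Fintype.card V - 1)) ≤ total (G.adjMatrix ℝ)) :
    ∃ U : Finset V, (Fintype.card V : ℝ) ≤ 2 * Fintype.card U ∧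
      (∀ X Y : Finset U, |∑ x ∈ X, ∑ y ∈ Y,
        ((Γ.comap (Subtype.val : U → V)).adjMatrix ℝ - p • ones U) x y|
          ≤ l * √((X.card : ℝ) * Y.card)) ∧
      (∀ v, ((Γ.comap (Subtype.val : U → V)).degree v : ℝ) ≤ 4 * (p * Fintype.card U)) ∧
      (1 / 2 + δ / 2) * p * (Fintype.card U : ℝ) ^ 2
        ≤ total ((G.comap (Subtype.val : U → V)).adjMatrix ℝ) := by
  classical
  obtain ⟨U, hU, hdeg, hUtot⟩ := exists_finset_degree_le hG hp hδ hcut hlκ hκ0 hκ hκδ hn htot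
  refine ⟨U, by rwa [Fintype.card_coe], fun X Y => ?_, fun v => ?_, ?_⟩
  · have h := hcut (X.map (Function.Embedding.subtype _)) (Y.map (Function.Embedding.subtype _))
    simp only [Finset.sum_map, Finset.card_map] at h
    exact h
  · rw [Fintype.card_coe]
    have h1 : (Γ.comap (Subtype.val : U → V)).degree v ≤ Γ.degree v := by
      rw [← card_neighborFinset_eq_degree, ← card_neighborFinset_eq_degree,
        ← Finset.card_map (Function.Embedding.subtype _)]
      refine Finset.card_le_card fun w hw => ?_
      obtain ⟨w', hw', rfl⟩ := Finset.mem_map.mp hw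
      rw [mem_neighborFinset] at hw' ⊢
      exact hw'
    have h2 := hdeg v v.2
    have h3 : ((Γ.comap (Subtype.val : U → V)).degree v : ℝ) ≤ Γ.degree v := by exact_mod_cast h1
    -- As `U` contains at least half of the vertices, the degree bound `2pn` becomes `4p|U|`.
    have h4 := mul_le_mul_of_nonneg_left hU hp.le
    linarith
  · rw [Fintype.card_coe]
    refine hUtot.trans (le_of_eq ?_)
    rw [total, ← Finset.sum_coe_sort U]
    refine Finset.sum_congr rfl fun x _ => ?_
    rw [← Finset.sum_coe_sort U]
    rfl

end Restriction

/-! ### Numerical conditions and the lower bound on the density. -/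

section Parameters

/-- The parameter conditions that hold for all large `n`. -/
lemma eventually_parameters (m : ℕ) {γ δ : ℝ} (hγ : 0 < γ) (hδ : 0 < δ) :
    ∃ N : ℕ, ∀ n : ℕ, N ≤ n → 1 ≤ Real.log n ∧ 2 + 4 * δ ≤ δ * n ∧
      4 * Real.log n ^ m ≤ γ * n ∧ 2 ^ (m + 3) ≤ 16 * γ ^ 2 * n := by
  have h1 : ∀ᶠ n : ℕ in Filter.atTop, 1 ≤ Real.log n :=
    (Real.tendsto_log_atTop.comp tendsto_natCast_atTop_atTop).eventually_ge_atTop 1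
  have h2 : ∀ᶠ n : ℕ in Filter.atTop, (2 + 4 * δ) / δ ≤ n :=
    tendsto_natCast_atTop_atTop.eventually_ge_atTop _
  have h3 : ∀ᶠ n : ℕ in Filter.atTop, 2 ^ (m + 3) / (16 * γ ^ 2) ≤ n :=
    tendsto_natCast_atTop_atTop.eventually_ge_atTop _
  have h4 : ∀ᶠ n : ℕ in Filter.atTop, ‖Real.log n ^ m‖ ≤ γ / 4 * ‖(n : ℝ)‖ :=
    tendsto_natCast_atTop_atTop.eventually
      ((Real.isLittleO_pow_log_id_atTop (n := m)).def (by positivity : 0 < γ / 4))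
  obtain ⟨N, hN⟩ := Filter.eventually_atTop.mp (h1.and (h2.and (h3.and h4)))
  refine ⟨N, fun n hn => ?_⟩
  obtain ⟨a1, a2, a3, a4⟩ := hN n hn
  refine ⟨a1, ?_, ?_, ?_⟩
  · rw [div_le_iff₀ hδ] at a2
    linarith
  · rw [Real.norm_of_nonneg (by positivity), Real.norm_of_nonneg (by positivity)] at a4
    linarith
  · rw [div_le_iff₀ (by positivity)] at a3
    linarith

/-- Jumbledness forces `β` to be large, so the upper bound on `β` bounds the density from below. -/
lemma density_bounds {V : Type*} [Fintype V] [DecidableEq V] {Γ : SimpleGraph V}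
    [DecidableRel Γ.Adj] {K : ℕ}
    {γ p q β : ℝ} (hγ : 0 < γ) (hp1 : p ≤ 1) (hq : 0 < q)
    (hqp : q ^ (2 * K + 1) = p) (hlog : 1 ≤ Real.log (Fintype.card V))
    (hN1 : 4 * Real.log (Fintype.card V) ^ (2 * K) ≤ γ * Fintype.card V)
    (hN2 : 2 ^ (2 * K + 3) ≤ 16 * γ ^ 2 * (Fintype.card V : ℝ)) (hΓ : IsJumbled Γ p β)
    (hβ : β ≤ γ * (p * q) * Fintype.card V * (Real.log (Fintype.card V) ^ (2 * K))⁻¹)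
    {v : V} (hv : p * Fintype.card V / 4 ≤ Γ.degree v) :
    0 ≤ β ∧ p ≤ γ * (p * q) * Fintype.card V * (Real.log (Fintype.card V) ^ (2 * K))⁻¹ ∧
      1 ≤ 16 * γ ^ 2 * q ^ (2 * K + 3) * Fintype.card V := by
  set n : ℝ := (Fintype.card V : ℝ) with hn
  have hp : 0 < p := by rw [← hqp]; positivity
  have hn0 : 0 < n := by
    rw [hn]
    exact_mod_cast Fintype.card_pos_iff.mpr ⟨v⟩
  have hq1 : q ≤ 1 := by
    by_contra hcon
    have := one_lt_pow₀ (not_le.mp hcon) (show 2 * K + 1 ≠ 0 by omega)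
    linarith
  have hdeg0 : 0 < Γ.degree v := by
    have : (0 : ℝ) < Γ.degree v := lt_of_lt_of_le (by positivity) hv
    exact_mod_cast this
  have hroot := sqrt_degree_le_of_isJumbled hΓ hdeg0
  have hdeg1 : (1 : ℝ) ≤ Γ.degree v := by exact_mod_cast hdeg0
  have hsq : 1 ≤ √(Γ.degree v : ℝ) := Real.one_le_sqrt.mpr hdeg1
  have hL : 1 ≤ Real.log n ^ (2 * K) := one_le_pow₀ hlog
  have hβ0 : 0 ≤ β := le_trans (mul_nonneg (by linarith) (by positivity)) hroot
  refine ⟨hβ0, ?_⟩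
  -- For `p` near 1 jumbledness need not force `β` to be large, but then `q ≥ 1/2` and large `n`
  -- suffices. For `p < 1/2` the vertex `v` gives `β ≥ √(deg v) / 2`.
  rcases le_or_gt (1 / 2) p with hhalf | hhalf
  · have hqp' : p ≤ q := by
      rw [← hqp]
      exact pow_le_of_le_one hq.le hq1 (by omega)
    have hqhalf : 1 / 2 ≤ q := hhalf.trans hqp'
    constructor
    · refine hp1.trans ?_
      rw [← div_eq_mul_inv, le_div_iff₀ (by positivity)]
      have h1 : 1 / 4 ≤ p * q := by nlinarith
      have h2 : γ * n * (1 / 4) ≤ γ * n * (p * q) := by gcongr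
      linarith
    · have h1 : (1 / 2 : ℝ) ^ (2 * K + 3) ≤ q ^ (2 * K + 3) :=
        pow_le_pow_left₀ (by norm_num) hqhalf _
      have h2 := mul_le_mul_of_nonneg_left h1 (show 0 ≤ 16 * γ ^ 2 * n by positivity)
      have h3 := mul_le_mul_of_nonneg_right hN2 (show (0 : ℝ) ≤ (1 / 2) ^ (2 * K + 3) by positivity)
      rw [← mul_pow, mul_one_div_cancel two_ne_zero, one_pow] at h3
      linarith
  · have hβhalf : √(Γ.degree v : ℝ) / 2 ≤ β := by
      refine le_trans ?_ hroot
      have : 0 ≤ √(Γ.degree v : ℝ) := by positivity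
      nlinarith
    refine ⟨by linarith, ?_⟩
    have h1 : β ≤ γ * (p * q) * n := hβ.trans (mul_le_of_le_one_right (by positivity)
      (inv_le_one_of_one_le₀ hL))
    have h2 := pow_le_pow_left₀ (by positivity) (hβhalf.trans h1) 2
    rw [div_pow, Real.sq_sqrt (by positivity)] at h2
    have h3 : p * n / 16 ≤ (γ * (p * q) * n) ^ 2 := by linarith
    have h4 : p * q ^ 2 = q ^ (2 * K + 3) := by rw [← hqp]; ring
    rw [← h4]
    refine le_of_mul_le_mul_left ?_ (show 0 < p * n / 16 by positivity)
    calc p * n / 16 * 1 ≤ (γ * (p * q) * n) ^ 2 := by linarith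
      _ = _ := by ring

end Parameters

end JumbledTuran

namespace JumbledTuran

open Matrix SimpleGraph

/-! ### From jumbled graphs to cycles. -/

section Final

lemma exists_degree_ge {V : Type*} [Fintype V] [DecidableEq V] {Γ G : SimpleGraph V}
    [DecidableRel Γ.Adj] [DecidableRel G.Adj] {p δ : ℝ} (hG : G ≤ Γ) (hp : 0 < p) (hδ : 0 < δ)
    (hn : (2 : ℝ) ≤ Fintype.card V)
    (htot : (1 / 2 + δ) * p * (Fintype.card V * (Fintype.card V - 1)) ≤ total (G.adjMatrix ℝ)) :
    ∃ v, p * Fintype.card V / 4 ≤ (Γ.degree v : ℝ) := by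
  have hne : Nonempty V := by
    rw [← Fintype.card_pos_iff]
    have : (0 : ℝ) < Fintype.card V := by linarith
    exact_mod_cast this
  have h1 : total (G.adjMatrix ℝ) ≤ ∑ v, (Γ.degree v : ℝ) := Finset.sum_le_sum fun v _ => by
    rw [sum_adjMatrix_row]
    exact_mod_cast degree_le_of_le hG
  have h2 : ∑ _v : V, p * Fintype.card V / 4 ≤ ∑ v, (Γ.degree v : ℝ) := by
    refine le_trans ?_ (htot.trans h1)
    rw [Finset.sum_const, Finset.card_univ, nsmul_eq_mul]
    set n : ℝ := (Fintype.card V : ℝ)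
    have h3 : 0 ≤ p * n * (n - 2) := mul_nonneg (by positivity) (by linarith)
    have h4 : 0 ≤ δ * p * (n * (n - 1)) :=
      mul_nonneg (by positivity) (mul_nonneg (by linarith) (by linarith))
    linarith
  obtain ⟨v, -, hv⟩ := Finset.exists_le_of_sum_le Finset.univ_nonempty h2
  exact ⟨v, hv⟩

/-- Reduction to an induced subgraph of bounded degree, with all parameters under control. -/
lemma exists_induced_of_isJumbled {V : Type*} [Fintype V] [DecidableEq V] {Γ G : SimpleGraph V}
    [DecidableRel Γ.Adj] [DecidableRel G.Adj] {K : ℕ} {γ δ p q β : ℝ} (hγ : 0 < γ)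
    (hγ1 : 100 * γ ≤ 1) (hγδ : 100 * γ ≤ δ) (hδ : 0 < δ) (hp1 : p ≤ 1) (hq : 0 < q)
    (hqp : q ^ (2 * K + 1) = p) (hlog : 1 ≤ Real.log (Fintype.card V))
    (hn : 2 + 4 * δ ≤ δ * Fintype.card V)
    (hN1 : 4 * Real.log (Fintype.card V) ^ (2 * K) ≤ γ * Fintype.card V)
    (hN2 : 2 ^ (2 * K + 3) ≤ 16 * γ ^ 2 * (Fintype.card V : ℝ)) (hΓ : IsJumbled Γ p β)
    (hβ : β ≤ γ * (p * q) * Fintype.card V * (Real.log (Fintype.card V) ^ (2 * K))⁻¹)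
    (hG : G ≤ Γ)
    (htot : (1 / 2 + δ) * p * (Fintype.card V * (Fintype.card V - 1)) ≤ total (G.adjMatrix ℝ)) :
    0 ≤ 2 * β + p ∧
    2 * β + p ≤ 3 * (γ * (p * q) * Fintype.card V * (Real.log (Fintype.card V) ^ (2 * K))⁻¹) ∧
    1 ≤ 16 * γ ^ 2 * q ^ (2 * K + 3) * Fintype.card V ∧
    ∃ U : Finset V, (Fintype.card V : ℝ) ≤ 2 * Fintype.card U ∧
      (∀ X Y : Finset U, |∑ x ∈ X, ∑ y ∈ Y,
        ((Γ.comap (Subtype.val : U → V)).adjMatrix ℝ - p • ones U) x y|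
          ≤ (2 * β + p) * √((X.card : ℝ) * Y.card)) ∧
      (∀ v, ((Γ.comap (Subtype.val : U → V)).degree v : ℝ) ≤ 4 * (p * Fintype.card U)) ∧
      (1 / 2 + δ / 2) * p * (Fintype.card U : ℝ) ^ 2
        ≤ total ((G.comap (Subtype.val : U → V)).adjMatrix ℝ) := by
  have hp : 0 < p := by rw [← hqp]; positivity
  have hn2 : (2 : ℝ) ≤ Fintype.card V := by
    have : 4 * δ ≤ δ * Fintype.card V := by linarith
    have := le_of_mul_le_mul_left (by linarith : δ * 4 ≤ δ * Fintype.card V) hδ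
    linarith
  obtain ⟨v, hv⟩ := exists_degree_ge hG hp hδ hn2 htot
  obtain ⟨hβ0, hpR, hdens⟩ := density_bounds hγ hp1 hq hqp hlog hN1 hN2 hΓ hβ hv
  have hq1 : q ≤ 1 := by
    by_contra hcon
    have := one_lt_pow₀ (not_le.mp hcon) (show 2 * K + 1 ≠ 0 by omega)
    linarith
  have hl : 2 * β + p
      ≤ 3 * (γ * (p * q) * Fintype.card V * (Real.log (Fintype.card V) ^ (2 * K))⁻¹) := by
    linarith
  have hl0 : 0 ≤ 2 * β + p := by linarith
  refine ⟨hl0, hl, hdens, exists_induced_of_cut (κ := 9 * γ ^ 2) hG hp hδ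
    (abs_sum_le_of_isJumbled hp.le hβ0 hΓ) ?_ (by positivity) (by nlinarith) (by nlinarith) hn htot⟩
  have h1 : 2 * β + p ≤ 3 * (γ * (p * Fintype.card V)) := by
    refine hl.trans (mul_le_mul_of_nonneg_left ?_ (by norm_num))
    calc γ * (p * q) * Fintype.card V * (Real.log (Fintype.card V) ^ (2 * K))⁻¹
        ≤ γ * (p * 1) * Fintype.card V * 1 := by
          gcongr
          exact inv_le_one_of_one_le₀ (one_le_pow₀ hlog)
      _ = _ := by ring
  calc (2 * β + p) ^ 2 ≤ (3 * (γ * (p * Fintype.card V))) ^ 2 := pow_le_pow_left₀ hl0 h1 2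
    _ = _ := by ring

lemma adjMatrix_col_sum_le {V : Type*} [Fintype V] {Γ : SimpleGraph V} [DecidableRel Γ.Adj]
    {D : ℝ} (h : ∀ v, (Γ.degree v : ℝ) ≤ D) (j : V) : ∑ i, Γ.adjMatrix ℝ i j ≤ D := by
  refine le_trans (le_of_eq ?_) (h j)
  simp [adjMatrix_apply, ← card_neighborFinset_eq_degree, neighborFinset_eq_filter, Γ.adj_comm]

lemma total_ge_of_edges {V : Type*} [Fintype V] (G : SimpleGraph V) [DecidableRel G.Adj]
    {c : ℝ} (h : c * ((Fintype.card V).choose 2 : ℝ) ≤ G.edgeSet.ncard) :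
    c * (Fintype.card V * (Fintype.card V - 1)) ≤ total (G.adjMatrix ℝ) := by
  rw [total_adjMatrix]
  rw [Nat.cast_choose_two] at h
  linarith

/-- The case of triangles. -/
theorem exists_triangle_of_isJumbled {δ : ℝ} (hδ : 0 < δ) :
    ∃ γ : ℝ, 0 < γ ∧ ∃ N : ℕ, ∀ (V : Type*) [Fintype V] (Γ G : SimpleGraph V) (p β : ℝ),
      N ≤ Fintype.card V → 0 < p → p ≤ 1 → IsJumbled Γ p β →
      β ≤ γ * (p * p) * Fintype.card V → G ≤ Γ →
      (1 / 2 + δ) * p * ((Fintype.card V).choose 2 : ℝ) ≤ G.edgeSet.ncard →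
      (cycleGraph 3).IsContained G := by
  classical
  have hmin : 0 < min 1 δ := lt_min one_pos hδ
  -- `6144 = 3 · 2 · 1024`: from `2β + p`, from `n ≤ 2|U|`, and from `δ / 512` with `δ` halved.
  set γ := min 1 δ / 6144 with hγdef
  have hγ : 0 < γ := by positivity
  have hγ1 : 6144 * γ ≤ 1 := by
    rw [hγdef, mul_div_cancel₀ _ (by norm_num)]; exact min_le_left _ _
  have hγδ : 6144 * γ ≤ δ := by
    rw [hγdef, mul_div_cancel₀ _ (by norm_num)]; exact min_le_right _ _
  obtain ⟨N, hN⟩ := eventually_parameters (2 * 0) hγ hδ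
  refine ⟨γ, hγ, N, fun V _ Γ G p β hNV hp hp1 hΓ hβ hG hedge => ?_⟩
  obtain ⟨hlog, hn, hN1, hN2⟩ := hN _ hNV
  obtain ⟨hl0, hl, -, U, hU, hcut, hdeg, htot⟩ := exists_induced_of_isJumbled (K := 0) (q := p) hγ
    (by linarith) (by linarith) hδ hp1 hp (by simp) hlog hn hN1 hN2 hΓ (by simpa using hβ) hG
    (total_ge_of_edges G hedge)
  have hU0 : Nonempty U := by
    rw [← Fintype.card_pos_iff]
    by_contra hcon
    have h0 : Fintype.card U = 0 := by omega
    rw [h0] at hU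
    have : δ * Fintype.card V ≤ 0 :=
      mul_nonpos_of_nonneg_of_nonpos hδ.le (by simpa using hU)
    linarith
  refine (triangle_isContained_of_cut (Γ := Γ.comap (Subtype.val : U → V))
    (G := G.comap (Subtype.val : U → V)) (δ := δ / 2) (by positivity) (fun _ _ h => hG h) (add_sub_cancel _ _).symm
    hp hp1 hl0 hcut hdeg htot ?_).trans (SimpleGraph.Embedding.comap (Function.Embedding.subtype _) G).isContained
  refine hl.trans ?_
  have h1 : 3 * γ * (p * p) * Fintype.card V ≤ 3 * γ * (p * p) * (2 * Fintype.card U) := by gcongr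
  have h2 : 6144 * γ * (p * p * Fintype.card U) ≤ δ * (p * p * Fintype.card U) := by gcongr
  simp only [mul_zero, pow_zero, inv_one, mul_one]
  linarith

/-- The case of odd cycles of length at least five. -/
theorem exists_cycle_of_isJumbled (K : ℕ) {δ : ℝ} (hδ : 0 < δ) :
    ∃ γ : ℝ, 0 < γ ∧ ∃ N : ℕ, ∀ (V : Type*) [Fintype V] (Γ G : SimpleGraph V) (p q β : ℝ),
      N ≤ Fintype.card V → 0 < q → p ≤ 1 → q ^ (2 * K + 3) = p → IsJumbled Γ p β →
      β ≤ γ * (p * q) * Fintype.card V * (Real.log (Fintype.card V) ^ (2 * (K + 1)))⁻¹ → G ≤ Γ →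
      (1 / 2 + δ) * p * ((Fintype.card V).choose 2 : ℝ) ≤ G.edgeSet.ncard →
      (cycleGraph (2 * K + 5)).IsContained G := by
  classical
  obtain ⟨η, hη, hcore⟩ := cycleGraph_isContained_of_spectral K (half_pos hδ)
  have hmin : 0 < min 1 (min δ η) := lt_min one_pos (lt_min hδ hη)
  -- `768 = 24 · 32`, the product of the constants in `hlT` and `hdens'`.
  set γ := min 1 (min δ η) / 768 with hγdef
  have hγ : 0 < γ := by positivity
  have hγ1 : 768 * γ ≤ 1 := by
    rw [hγdef, mul_div_cancel₀ _ (by norm_num)]; exact min_le_left _ _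
  have hγδ : 768 * γ ≤ δ := by
    rw [hγdef, mul_div_cancel₀ _ (by norm_num)]
    exact (min_le_right _ _).trans (min_le_left _ _)
  have hγη : 768 * γ ≤ η := by
    rw [hγdef, mul_div_cancel₀ _ (by norm_num)]
    exact (min_le_right _ _).trans (min_le_right _ _)
  obtain ⟨N, hN⟩ := eventually_parameters (2 * (K + 1)) hγ hδ
  refine ⟨γ, hγ, N, fun V _ Γ G p q β hNV hq hp1 hqp hΓ hβ hG hedge => ?_⟩
  have hp : 0 < p := by rw [← hqp]; positivity
  have hq1 : q ≤ 1 := by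
    by_contra hcon
    have := one_lt_pow₀ (not_le.mp hcon) (show 2 * K + 3 ≠ 0 by omega)
    linarith
  obtain ⟨hlog, hn, hN1, hN2⟩ := hN _ hNV
  obtain ⟨hl0, hl, hdens, U, hU, hcut, hdeg, htot⟩ := exists_induced_of_isJumbled (K := K + 1) hγ
    (by linarith) (by linarith) hδ hp1 hq hqp hlog hn hN1 hN2 hΓ hβ hG
    (total_ge_of_edges G hedge)
  have hU0 : Nonempty U := by
    rw [← Fintype.card_pos_iff]
    by_contra hcon
    have h0 : Fintype.card U = 0 := by omega
    rw [h0] at hU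
    have : δ * Fintype.card V ≤ 0 :=
      mul_nonpos_of_nonneg_of_nonpos hδ.le (by simpa using hU)
    linarith
  set n : ℝ := (Fintype.card V : ℝ) with hndef
  set u : ℝ := (Fintype.card U : ℝ) with hudef
  have hu0 : 0 < u := by rw [hudef]; exact_mod_cast Fintype.card_pos
  have hun : u ≤ n := by
    rw [hudef, hndef, Fintype.card_coe]
    exact_mod_cast U.card_le_univ
  set h : ℝ := (harmonic (Fintype.card U) : ℝ) with hh
  have hh0 : 0 ≤ h := by
    have := harmonic_mono (Nat.zero_le (Fintype.card U))
    rw [harmonic_zero] at this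
    rw [hh]
    exact_mod_cast this
  have hhlog : h ≤ 2 * Real.log n := by
    have h1 : h ≤ 1 + Real.log u := harmonic_le_one_add_log _
    have h2 := Real.log_le_log hu0 hun
    linarith
  set T := p * u with hT
  have hT0 : 0 < T := by positivity
  set l := 2 * (2 * β + p) * h with hldef
  have hl0' : 0 ≤ l := by positivity
  -- The operator norm costs one logarithm, absorbed by the power of `log n` in the bound on `β`.
  have hlT : l ≤ 24 * γ * (q * T) := by
    have hlogpos : 0 < Real.log n := by linarith
    have h1 : (Real.log n ^ (2 * (K + 1)))⁻¹ * Real.log n ≤ 1 := by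
      rw [inv_mul_le_iff₀ (by positivity), mul_one]
      exact le_self_pow₀ hlog (by omega)
    calc l ≤ 2 * (3 * (γ * (p * q) * n * (Real.log n ^ (2 * (K + 1)))⁻¹)) * (2 * Real.log n) := by
          rw [hldef]; gcongr
      _ = 12 * (γ * (p * q) * n) * ((Real.log n ^ (2 * (K + 1)))⁻¹ * Real.log n) := by ring
      _ ≤ 12 * (γ * (p * q) * n) * 1 := by gcongr
      _ ≤ 12 * (γ * (p * q) * (2 * u)) * 1 := by gcongr
      _ = _ := by rw [hT]; ring
  have hpow : ∀ m : ℕ, m ≠ 0 → l ^ m ≤ 24 * γ * (q * T) ^ m := fun m hm => by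
    calc l ^ m ≤ (24 * γ * (q * T)) ^ m := pow_le_pow_left₀ hl0' hlT m
      _ = (24 * γ) ^ m * (q * T) ^ m := mul_pow _ _ _
      _ ≤ 24 * γ * (q * T) ^ m := by
          gcongr
          exact pow_le_of_le_one (by positivity) (by linarith) hm
  have hdens' : 1 ≤ 32 * γ ^ 2 * (q ^ (2 * K + 5) * u) := by
    have h1 : 16 * γ ^ 2 * q ^ (2 * K + 5) * n ≤ 16 * γ ^ 2 * q ^ (2 * K + 5) * (2 * u) := by
      gcongr
    rw [show 2 * (K + 1) + 3 = 2 * K + 5 by ring] at hdens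
    linarith
  have hcore' := hcore U (Γ.comap (Subtype.val : U → V)) (G.comap (Subtype.val : U → V))
    ((Γ.comap (Subtype.val : U → V)).adjMatrix ℝ - p • ones U) p l
    (fun _ _ h => hG h) (add_sub_cancel _ _).symm hp hp1 hl0'
    (sum_mulVec_sq_le_of_cut hcut) (adjMatrix_col_sum_le hdeg) htot ?_ ?_ ?_ ?_
  · exact hcore'.trans
      (SimpleGraph.Embedding.comap (Function.Embedding.subtype _) G).isContained
  · refine hlT.trans ?_
    have : q * T ≤ 1 * T := by gcongr
    rw [one_mul] at this
    exact mul_le_mul (by linarith) this (by positivity) hη.le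
  -- As `q` is the `(2 * K + 3)`-rd root of `p`, the extra factor `q` in the bound on `β` yields
  -- exactly the factor `p` required.
  · refine (hpow _ (by omega)).trans ?_
    rw [mul_pow, hqp]
    gcongr
    linarith
  · have h1 := mul_le_mul_of_nonneg_left (hpow (2 * K + 1) (by omega)) hu0.le
    refine h1.trans ?_
    -- The density bound supplies `q ^ (2 * K + 5) * u`; multiplied by `q ^ (2 * K + 1)` it gives
    -- the missing `p ^ 2`.
    have h2 : 24 * γ ≤ η * (q ^ (2 * K + 5) * u) := by
      have h3 : 24 * γ * 1 ≤ 24 * γ * (32 * γ ^ 2 * (q ^ (2 * K + 5) * u)) := by gcongr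
      have h4 : 768 * γ ^ 3 ≤ η := by
        have : γ ^ 3 ≤ γ := pow_le_of_le_one hγ.le (by linarith) (by norm_num)
        linarith
      have h5 : 768 * γ ^ 3 * (q ^ (2 * K + 5) * u) ≤ η * (q ^ (2 * K + 5) * u) := by gcongr
      linarith
    have h6 : q ^ (2 * K + 5) * q ^ (2 * K + 1) = p ^ 2 := by
      rw [← hqp]; ring
    calc u * (24 * γ * (q * T) ^ (2 * K + 1))
        = 24 * γ * (u * q ^ (2 * K + 1) * T ^ (2 * K + 1)) := by rw [mul_pow]; ring
      _ ≤ η * (q ^ (2 * K + 5) * u) * (u * q ^ (2 * K + 1) * T ^ (2 * K + 1)) := by gcongr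
      _ = η * (q ^ (2 * K + 5) * q ^ (2 * K + 1)) * u ^ 2 * T ^ (2 * K + 1) := by ring
      _ = η * (p * u) ^ 2 * T ^ (2 * K + 1) := by rw [h6]; ring
      _ = η * T ^ (2 * K + 3) := by rw [← hT]; ring
  · refine hdens'.trans ?_
    have h1 : q ^ (2 * K + 5) ≤ p := by
      rw [← hqp]
      exact pow_le_pow_of_le_one hq.le hq1 (by omega)
    have h2 : 32 * γ ^ 2 ≤ η := by nlinarith
    rw [← hudef]
    gcongr

end Final

end JumbledTuran

/-! ### Assembly: the real exponent, the two cases and the Turán number. -/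

theorem mainTheorem1 (k : ℕ) (hk : 1 ≤ k) (δ : ℝ) (hδ : 0 < δ) :
    ∃ γ : ℝ, 0 < γ ∧
      ∀ p : ℕ → ℝ, (∀ n, 0 ≤ p n ∧ p n ≤ 1) →
        ∃ n₀ : ℕ, ∀ n : ℕ, n₀ ≤ n → 0 < p n →
          ∀ (V : Type*) [Fintype V], Fintype.card V = n →
            ∀ (Γ : SimpleGraph V) (β : ℝ),
              JumbledTuran.IsJumbled Γ (p n) β →
              β ≤ γ * (p n) ^ (1 + 1 / (2 * (k : ℝ) - 1)) * (n : ℝ) *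
                    (Real.log (n : ℝ) ^ (2 * (k - 1)))⁻¹ →
              (∀ G : SimpleGraph V, G ≤ Γ →
                (1 / 2 + δ) * p n * (n.choose 2 : ℝ) ≤ (G.edgeSet.ncard : ℝ) →
                (SimpleGraph.cycleGraph (2 * k + 1)).IsContained G) ∧
              (JumbledTuran.genTuranNumber Γ (SimpleGraph.cycleGraph (2 * k + 1)) : ℝ)
                < (1 / 2 + δ) * p n * (n.choose 2 : ℝ) := by
  suffices H : ∃ γ : ℝ, 0 < γ ∧ ∃ N : ℕ, ∀ (V : Type _) [Fintype V] (Γ G : SimpleGraph V)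
      (p β : ℝ), N ≤ Fintype.card V → 0 < p → p ≤ 1 → JumbledTuran.IsJumbled Γ p β →
      β ≤ γ * p ^ (1 + 1 / (2 * (k : ℝ) - 1)) * (Fintype.card V : ℝ) *
        (Real.log (Fintype.card V : ℝ) ^ (2 * (k - 1)))⁻¹ → G ≤ Γ →
      (1 / 2 + δ) * p * ((Fintype.card V).choose 2 : ℝ) ≤ G.edgeSet.ncard →
      (SimpleGraph.cycleGraph (2 * k + 1)).IsContained G by
    obtain ⟨γ, hγ, N, hN⟩ := H
    -- The threshold is uniform over all density sequences; `n ≥ 2` makes the right side positive.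
    refine ⟨γ, hγ, fun p hp => ⟨max N 2, fun n hn hpn V _ hV Γ β hΓ hβ => ?_⟩⟩
    subst hV
    have hcycle := fun (G : SimpleGraph V) (hG : G ≤ Γ) hedge =>
      hN V Γ G (p _) β ((le_max_left _ _).trans hn) hpn (hp _).2 hΓ hβ hG hedge
    refine ⟨hcycle, ?_⟩
    rw [JumbledTuran.genTuranNumber]
    set S := {m | ∃ G' : SimpleGraph V, G' ≤ Γ ∧
      (SimpleGraph.cycleGraph (2 * k + 1)).Free G' ∧ G'.edgeSet.ncard = m} with hS
    rcases S.eq_empty_or_nonempty with hemp | hne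
    · rw [hemp, csSup_empty]
      have h2 : 0 < (Fintype.card V).choose 2 := Nat.choose_pos ((le_max_right _ _).trans hn)
      have h3 : (0 : ℝ) < ((Fintype.card V).choose 2 : ℝ) := by exact_mod_cast h2
      simp only [bot_eq_zero', Nat.cast_zero]
      positivity
    · have hbdd : BddAbove S := by
        refine ⟨Γ.edgeSet.ncard, ?_⟩
        rintro m ⟨G', hG', -, rfl⟩
        exact Set.ncard_le_ncard (SimpleGraph.edgeSet_mono hG') (Set.toFinite _)
      obtain ⟨G', hG', hfree, hcard⟩ := Nat.sSup_mem hne hbdd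
      rw [← hcard]
      by_contra hcon
      exact hfree (hcycle G' hG' (not_lt.mp hcon))
  obtain ⟨k, rfl⟩ := Nat.exists_eq_add_of_le' hk
  -- The root `q` replaces the real exponent by natural powers; after the shift of `k`, `2k - 1`
  -- reads `2 * k + 1`.
  have hpow : ∀ p : ℝ, 0 < p → ∃ q : ℝ, 0 < q ∧ q ^ (2 * k + 1) = p ∧
      p ^ (1 + 1 / (2 * ((k + 1 : ℕ) : ℝ) - 1)) = p * q := by
    intro p hp
    have e : 2 * ((k + 1 : ℕ) : ℝ) - 1 = ((2 * k + 1 : ℕ) : ℝ) := by push_cast; ring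
    refine ⟨p ^ (((2 * k + 1 : ℕ) : ℝ)⁻¹), by positivity,
      Real.rpow_inv_natCast_pow hp.le (by omega), ?_⟩
    rw [e, Real.rpow_add hp, Real.rpow_one, one_div]
  rcases k with _ | K
  · obtain ⟨γ, hγ, N, hN⟩ := JumbledTuran.exists_triangle_of_isJumbled hδ
    refine ⟨γ, hγ, N, fun V _ Γ G p β hNV hp hp1 hΓ hβ hG hedge => ?_⟩
    obtain ⟨q, -, hqp, hpq⟩ := hpow p hp
    obtain rfl : q = p := by simpa using hqp
    rw [hpq] at hβ
    exact hN V Γ G q β hNV hp hp1 hΓ (by simpa using hβ) hG hedge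
  · obtain ⟨γ, hγ, N, hN⟩ := JumbledTuran.exists_cycle_of_isJumbled K hδ
    refine ⟨γ, hγ, N, fun V _ Γ G p β hNV hp hp1 hΓ hβ hG hedge => ?_⟩
    obtain ⟨q, hq, hqp, hpq⟩ := hpow p hp
    rw [hpq] at hβ
    exact hN V Γ G p q β hNV hq hp1 hqp hΓ hβ hG hedge
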